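/- Theorem 1. There is a randomized algorithm which, given any $d$-regular bipartite graph $G=(P,Q,E)$, $E\subseteq P\times Q$, with $|P|=|Q|=n\ge 1$, $d\ge 1$, in adjacency array representation (for each vertex, an array of length $d$ listing its neighbours in arbitrary order), finds a perfect matching of $G$ in $O(n\log n)$ time, both in expectation and with high probability. The constants do not depend on $d$ or $G$. Precisely: time is the number of unit-cost instructions of a randomized word RAM with $\log_2 n+O(1)$ or more bits per word. Its instructions are word arithmetic, memory access, jumps, reading one entry of an adjacency array, and drawing a uniformly random element of $\{0,\dots,m-1\}$ for a word $m$. There are a single program and constants $c$, $C$ and $D_a$ ($a>0$) such that, for all such $n,d,G$, all adjacency array representations of $G$, and all word lengths $w$ with $2^w\ge cn$, the running time $T$ of the program satisfies the following. 1. Whenever the program stops, its output is a perfect matching of $G$, and it stops with probability $1$. 2. If $n\ge 2$, then $\mathbf E[T]\le C\,n\log n$. 3. If $n\ge 2$, then $\Pr[T> D_a\,n\log n]\le n^{-a}$ for every $a>0$. -/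

import Mathlib

/-! ### Input: regular bipartite graphs in adjacency array representation -/

/-- An adjacency array representation of a `d`-regular bipartite graph `G` with sides
`P = Fin n` (left summand) and `Q = Fin n` (right summand): every vertex comes with an array of
length `d` that lists each of its neighbours exactly once, in an arbitrary order. -/
structure AdjArrays {n : ℕ} (G : SimpleGraph (Fin n ⊕ Fin n)) (d : ℕ) where
  /-- `left u i` is the `i`-th neighbour (in `Q`) of `u ∈ P`. -/
  left : Fin n → Fin d → Fin n
  /-- `right v i` is the `i`-th neighbour (in `P`) of `v ∈ Q`. -/
  right : Fin n → Fin d → Fin n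
  left_injective : ∀ u, Function.Injective (left u)
  right_injective : ∀ v, Function.Injective (right v)
  adj_iff_left : ∀ u v, G.Adj (Sum.inl u) (Sum.inr v) ↔ ∃ i, left u i = v
  adj_iff_right : ∀ u v, G.Adj (Sum.inl u) (Sum.inr v) ↔ ∃ i, right v i = u

/-! ### The machine: a randomized word RAM with unit cost instructions -/

namespace WordRAM

/-- Instructions of a word RAM with `k` registers. Register operands are elements of `Fin k`;
jump targets are positions in the program. -/
inductive Instr (k : ℕ) where
  /-- `dst := c` -/
  | const (dst : Fin k) (c : ℕ)
  /-- `dst := a` -/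
  | move (dst a : Fin k)
  /-- `dst := a + b` -/
  | add (dst a b : Fin k)
  /-- `dst := a - b` -/
  | sub (dst a b : Fin k)
  /-- `dst := a * b` -/
  | mul (dst a b : Fin k)
  /-- `dst := ⌊a / b⌋` -/
  | div (dst a b : Fin k)
  /-- `dst := memory[addr]` -/
  | load (dst addr : Fin k)
  /-- `memory[addr] := a` -/
  | store (addr a : Fin k)
  /-- `dst :=` the `i`-th entry of the adjacency array of the vertex `u ∈ P` -/
  | nbrLeft (dst u i : Fin k)
  /-- `dst :=` the `i`-th entry of the adjacency array of the vertex `v ∈ Q` -/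
  | nbrRight (dst v i : Fin k)
  /-- `dst :=` a fresh uniformly random element of `{0, …, a - 1}` -/
  | rand (dst a : Fin k)
  /-- unconditional jump -/
  | jump (target : ℕ)
  /-- jump if `a < b` -/
  | jumpLt (a b : Fin k) (target : ℕ)
  /-- jump if `a = b` -/
  | jumpEq (a b : Fin k) (target : ℕ)
  /-- stop -/
  | halt

/-- A configuration of a word RAM with `k` registers and `w`-bit words: program counter, registers,
and a memory of `w`-bit words addressed by `w`-bit words. -/
@[ext]
structure Config (k w : ℕ) where
  pc : ℕ
  reg : Fin k → BitVec w
  mem : BitVec w → BitVec w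

variable {k w : ℕ}

/-- Write `x` to the register `dst` and go on to the next instruction. -/
def Config.assign (s : Config k w) (dst : Fin k) (x : BitVec w) : Config k w :=
  ⟨s.pc + 1, Function.update s.reg dst x, s.mem⟩

/-- The entry `arr[u][i]` of a read-only input array as a word (`0` if an index is out of range). -/
def lookup {n d : ℕ} (arr : Fin n → Fin d → Fin n) (u i : BitVec w) : BitVec w :=
  if h : u.toNat < n ∧ i.toNat < d then
    BitVec.ofNat w (arr ⟨u.toNat, h.1⟩ ⟨i.toNat, h.2⟩ : ℕ)
  else 0

/-- The random values available in one step: for every `m` an element of `{0, …, m}`. A step looks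
at no more than one of them. -/
abbrev Sample : Type := (m : ℕ) → Fin (m + 1)

/-- The effect of one instruction. Arithmetic is that of `w`-bit words, that is, modulo `2 ^ w`
(and `a / 0 = 0`); words are compared as unsigned numbers. A random draw from the empty range
gives `0`. -/
def exec {n d : ℕ} {G : SimpleGraph (Fin n ⊕ Fin n)} (A : AdjArrays G d) (r : Sample)
    (s : Config k w) : Instr k → Config k w
  | .const dst c => s.assign dst (BitVec.ofNat w c)
  | .move dst a => s.assign dst (s.reg a)
  | .add dst a b => s.assign dst (s.reg a + s.reg b)
  | .sub dst a b => s.assign dst (s.reg a - s.reg b)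
  | .mul dst a b => s.assign dst (s.reg a * s.reg b)
  | .div dst a b => s.assign dst (BitVec.udiv (s.reg a) (s.reg b))
  | .load dst addr => s.assign dst (s.mem (s.reg addr))
  | .store addr a => ⟨s.pc + 1, s.reg, Function.update s.mem (s.reg addr) (s.reg a)⟩
  | .nbrLeft dst u i => s.assign dst (lookup A.left (s.reg u) (s.reg i))
  | .nbrRight dst v i => s.assign dst (lookup A.right (s.reg v) (s.reg i))
  | .rand dst a => s.assign dst (BitVec.ofNat w (r ((s.reg a).toNat - 1) : ℕ))
  | .jump target => ⟨target, s.reg, s.mem⟩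
  | .jumpLt a b target =>
      ⟨if (s.reg a).toNat < (s.reg b).toNat then target else s.pc + 1, s.reg, s.mem⟩
  | .jumpEq a b target => ⟨if s.reg a = s.reg b then target else s.pc + 1, s.reg, s.mem⟩
  | .halt => s

/-- The machine has stopped: the current instruction is `halt`, or there is none. -/
def Halted (prog : List (Instr k)) (s : Config k w) : Prop :=
  (prog[s.pc]?).getD .halt = .halt

/-- One step of the machine. A stopped machine does not change any more. -/
def step {n d : ℕ} {G : SimpleGraph (Fin n ⊕ Fin n)} (A : AdjArrays G d) (prog : List (Instr k))
    (r : Sample) (s : Config k w) : Config k w :=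
  exec A r s ((prog[s.pc]?).getD .halt)

/-- The initial configuration: register `0` holds `n`, register `1` holds `d`, all other registers
and all memory cells hold `0`. The adjacency arrays are accessible only through `nbrLeft` and
`nbrRight`. -/
def init (k w n d : ℕ) : Config k w where
  pc := 0
  reg i := if (i : ℕ) = 0 then BitVec.ofNat w n else if (i : ℕ) = 1 then BitVec.ofNat w d else 0
  mem _ := 0

/-- The configuration after `t` steps, given the outcome `ω` of all random draws. -/
def config {n d : ℕ} {G : SimpleGraph (Fin n ⊕ Fin n)} (A : AdjArrays G d) (prog : List (Instr k))
    (w : ℕ) (ω : ℕ → Sample) : ℕ → Config k w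
  | 0 => init k w n d
  | t + 1 => step A prog (ω t) (config A prog w ω t)

/-- The running time: the number of instructions executed before the machine stops
(`⊤` if it never stops). -/
noncomputable def runTime {n d : ℕ} {G : SimpleGraph (Fin n ⊕ Fin n)} (A : AdjArrays G d)
    (prog : List (Instr k)) (w : ℕ) (ω : ℕ → Sample) : ℕ∞ :=
  ⨅ (t : ℕ) (_ : Halted prog (config A prog w ω t)), (t : ℕ∞)

/-- The law of the random draws: all of them are independent, and a draw from `{0, …, m}` is
uniform. -/
noncomputable def coins : MeasureTheory.Measure (ℕ → Sample) :=
  MeasureTheory.Measure.infinitePi fun _ : ℕ =>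
    MeasureTheory.Measure.infinitePi fun m : ℕ => (PMF.uniformOfFintype (Fin (m + 1))).toMeasure

/-- The memory encodes a perfect matching of `G`: cell `u` holds the (index of the) partner of the
vertex `u ∈ P`, for `u = 0, …, n - 1`. -/
def EncodesPerfectMatching {n : ℕ} (G : SimpleGraph (Fin n ⊕ Fin n)) (mem : BitVec w → BitVec w) :
    Prop :=
  ∃ M : G.Subgraph, M.IsPerfectMatching ∧
    ∀ u : Fin n, ∃ v : Fin n,
      (mem (BitVec.ofNat w (u : ℕ))).toNat = (v : ℕ) ∧ M.Adj (Sum.inl u) (Sum.inr v)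

end WordRAM

/-! From an unmatched vertex of `P`, repeatedly move to a uniformly random neighbour in `Q` and on
to its mate, until an unmatched vertex of `Q` is met. With loops erased, the walk is then an
augmenting path. While `k` vertices are unmatched on each side, the walk starts at a random
unmatched vertex and is given up after `2 * (n / k + 1)` moves.

Regularity bounds the failure probability. Let `f b u` be the probability that the walk from `u`
survives `b` moves. Every vertex of `Q` is entered along `d` edges, so the sum of `f (b + 1)` over
`P` is the sum of `f b` over the matched part of `P`: the unmatched vertices account for the loss
from one sum to the next. Telescoping gives `b * ∑ f b ≤ n`, summed over the unmatched vertices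
(`mul_sum_survival_free_le`). With the chosen length, a random start fails with probability at most
1/2.

Both time bounds follow from one exponential moment, that of `q ^ T` with `q = exp (1 / (600 n))`.
When a walk starts with `k` unmatched vertices, this moment is at most a constant `K` times `k + 1`:
a walk with its augmentation costs `O(n / k)` instructions, a factor of at most `exp (1 / (6 k))`,
whereas the mean of the potential after the walk is at most `k + 1/2` (`walkStartBound`,
`exp_pow_mul_le`). Overall the moment is at most `3 (n + 1)`, so the machine is still running after
`t` steps with probability at most `3 (n + 1) exp (-t / (600 n))`. The moment is infinite if a wrong
halt is reachable, so its finiteness also gives correctness. -/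

open MeasureTheory ProbabilityTheory

/-! ### The machine as a Markov chain on a countable state space. -/

namespace WordRAM

variable {k w n d : ℕ} {G : SimpleGraph (Fin n ⊕ Fin n)}

/-- The law of the random values available in one step. -/
noncomputable def sampleLaw : Measure Sample :=
  Measure.infinitePi fun m : ℕ => (PMF.uniformOfFintype (Fin (m + 1))).toMeasure

instance : IsProbabilityMeasure sampleLaw := by unfold sampleLaw; infer_instance

instance : IsProbabilityMeasure coins := by unfold coins; infer_instance

instance : Countable (Config k w) :=
  Function.Injective.countable (f := fun s : Config k w => (s.pc, s.reg, s.mem))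
    fun s t h => by
      simp only [Prod.mk.injEq] at h
      exact Config.ext h.1 h.2.1 h.2.2

instance : MeasurableSpace (Config k w) := ⊤

instance : DiscreteMeasurableSpace (Config k w) := ⟨fun _ => trivial⟩

/-- A step reads one random value. -/
theorem exists_step_eq (A : AdjArrays G d) (prog : List (Instr k)) (s : Config k w) :
    ∃ (m : ℕ) (g : Fin (m + 1) → Config k w), ∀ r, step A prog r s = g (r m) := by
  unfold step
  generalize (prog[s.pc]?).getD .halt = ins
  by_cases h : ∃ dst a, ins = .rand dst a
  · obtain ⟨dst, a, rfl⟩ := h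
    exact ⟨(s.reg a).toNat - 1, fun x => s.assign dst (BitVec.ofNat w x), fun r => rfl⟩
  · refine ⟨0, fun _ => exec A (fun _ => 0) s ins, fun r => ?_⟩
    cases ins
    case rand dst a => exact absurd ⟨dst, a, rfl⟩ h
    all_goals rfl

theorem lintegral_sampleLaw_eval (m : ℕ) (f : Fin (m + 1) → ENNReal) :
    ∫⁻ r, f (r m) ∂sampleLaw = ∑ x, f x / (m + 1 : ℕ) := by
  have h := (measurePreserving_eval_infinitePi
    (fun m : ℕ => (PMF.uniformOfFintype (Fin (m + 1))).toMeasure) m).lintegral_comp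
    (f := f) (measurable_of_finite f)
  rw [sampleLaw]
  refine h.trans ?_
  rw [lintegral_fintype]
  refine Finset.sum_congr rfl fun x _ => ?_
  rw [PMF.toMeasure_apply_singleton _ _ (measurableSet_singleton x), PMF.uniformOfFintype_apply,
    Fintype.card_fin, div_eq_mul_inv]

theorem measurable_step (A : AdjArrays G d) (prog : List (Instr k)) (s : Config k w) :
    Measurable fun r => step A prog r s := by
  obtain ⟨m, g, hg⟩ := exists_step_eq A prog s
  simp only [hg]
  exact (measurable_of_finite g).comp (measurable_pi_apply m)

theorem measurable_uncurry_step (A : AdjArrays G d) (prog : List (Instr k)) :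
    Measurable fun p : Config k w × Sample => step A prog p.2 p.1 :=
  measurable_from_prod_countable_right fun s => measurable_step A prog s

theorem measurable_config (A : AdjArrays G d) (prog : List (Instr k)) (w t : ℕ) :
    Measurable fun ω => config A prog w ω t := by
  induction t with
  | zero => exact measurable_const
  | succ t ih =>
    exact (measurable_uncurry_step A prog).comp (ih.prodMk (measurable_pi_apply t))

theorem config_congr (A : AdjArrays G d) (prog : List (Instr k)) (w t : ℕ) {ω ω' : ℕ → Sample}
    (h : ∀ i < t, ω i = ω' i) : config A prog w ω t = config A prog w ω' t := by
  induction t with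
  | zero => rfl
  | succ t ih =>
    simp only [config]
    rw [ih fun i hi => h i (by omega), h t (by omega)]

theorem indepFun_config (A : AdjArrays G d) (prog : List (Instr k)) (w t : ℕ) :
    IndepFun (fun ω => config A prog w ω t) (fun ω : ℕ → Sample => ω t) coins := by
  have h : iIndepFun (fun i (ω : ℕ → Sample) => ω i) coins :=
    iIndepFun_infinitePi (P := fun _ : ℕ => sampleLaw) (X := fun _ => id) fun _ => measurable_id
  have h2 := h.indepFun_finset (Finset.range t) {t} (by simp) fun i => measurable_pi_apply i
  -- The configuration after `t` steps as a function of the first `t` samples alone; the later ones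
  -- are never read and are filled in with zeros.
  let φ : (Finset.range t → Sample) → Config k w := fun y =>
    config A prog w (fun i => if hi : i ∈ Finset.range t then y ⟨i, hi⟩ else fun _ => 0) t
  have hφ : Measurable φ := by
    refine (measurable_config A prog w t).comp (measurable_pi_lambda _ fun i => ?_)
    by_cases hi : i ∈ Finset.range t
    · simp only [hi, dite_true]; exact measurable_pi_apply _
    · simp only [hi, dite_false]; exact measurable_const
  have hψ : Measurable fun y : (({t} : Finset ℕ) → Sample) => y ⟨t, by simp⟩ :=
    measurable_pi_apply (X := fun _ : ({t} : Finset ℕ) => Sample) _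
  have h3 := h2.comp hφ hψ
  convert h3 using 1
  · funext ω
    refine config_congr A prog w t fun i hi => ?_
    simp [hi]
  · rfl

/-- The Markov property. -/
theorem lintegral_config_succ (A : AdjArrays G d) (prog : List (Instr k)) (w t : ℕ)
    (F : Config k w → ENNReal) :
    ∫⁻ ω, F (config A prog w ω (t + 1)) ∂coins =
      ∫⁻ ω, ∫⁻ r, F (step A prog r (config A prog w ω t)) ∂sampleLaw ∂coins := by
  have hF : Measurable fun p : Config k w × Sample => F (step A prog p.2 p.1) :=
    (measurable_of_countable F).comp (measurable_uncurry_step A prog)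
  have hmap := (indepFun_config A prog w t).map_prod_eq_prod_map_map
    (measurable_config A prog w t).aemeasurable (measurable_pi_apply t).aemeasurable
  have hlaw : Measure.map (fun ω : ℕ → Sample => ω t) coins = sampleLaw :=
    (measurePreserving_eval_infinitePi (fun _ : ℕ => sampleLaw) t).map_eq
  calc ∫⁻ ω, F (config A prog w ω (t + 1)) ∂coins
      = ∫⁻ p, F (step A prog p.2 p.1)
          ∂(Measure.map (fun ω => (config A prog w ω t, ω t)) coins) := by
        rw [lintegral_map hF ((measurable_config A prog w t).prodMk (measurable_pi_apply t))]
        rfl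
    _ = _ := by
        rw [hmap, hlaw, lintegral_prod _ hF.aemeasurable,
          lintegral_map (measurable_of_countable _) (measurable_config A prog w t)]

/-! ### Exponential cost -/

open Classical in
/-- A bound for the expectation of `q ^ T`, where `T` is the running time from `s`, cut off after
`t` steps; it is infinite if the machine may stop within `t` steps without satisfying `post`. -/
noncomputable def expCost (A : AdjArrays G d) (prog : List (Instr k)) (post : Config k w → Prop)
    (q : ENNReal) : ℕ → Config k w → ENNReal
  | 0, s => if Halted prog s ∧ ¬ post s then ⊤ else 1
  | t + 1, s =>
    if Halted prog s then if post s then 1 else ⊤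
    else q * ∫⁻ r, expCost A prog post q t (step A prog r s) ∂sampleLaw

section ExpCost

variable {A : AdjArrays G d} {prog : List (Instr k)} {post : Config k w → Prop} {q : ENNReal}

theorem one_le_expCost (hq : 1 ≤ q) (t : ℕ) (s : Config k w) : 1 ≤ expCost A prog post q t s := by
  induction t generalizing s with
  | zero => unfold expCost; split_ifs <;> simp
  | succ t ih =>
    unfold expCost
    split_ifs
    · simp
    · simp
    · refine one_le_mul hq ?_
      calc (1 : ENNReal) = ∫⁻ _, 1 ∂sampleLaw := by simp
        _ ≤ _ := lintegral_mono fun r => ih _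

/-- Monotonicity in the cutoff allows bounds for single instructions that do not lower it, so loops
can be analysed at a fixed cutoff. -/
theorem expCost_le_succ (hq : 1 ≤ q) (t : ℕ) (s : Config k w) :
    expCost A prog post q t s ≤ expCost A prog post q (t + 1) s := by
  induction t generalizing s with
  | zero =>
    have h := one_le_expCost (A := A) (prog := prog) (post := post) hq 1 s
    by_cases hs : Halted prog s
    · by_cases hp : post s <;> simp [expCost, hs, hp]
    · simpa [expCost, hs] using h
  | succ t ih =>
    rw [expCost, expCost]
    split_ifs
    · exact le_rfl
    · exact le_rfl
    · gcongr; exact ih _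

theorem expCost_of_halted {s : Config k w} (hs : Halted prog s) (hp : post s) (t : ℕ) :
    expCost A prog post q t s = 1 := by
  cases t <;> simp [expCost, hs, hp]

theorem expCost_succ_of_step {s s' : Config k w} (hs : ¬ Halted prog s)
    (h : ∀ r, step A prog r s = s') (t : ℕ) :
    expCost A prog post q (t + 1) s = q * expCost A prog post q t s' := by
  rw [expCost, if_neg hs]
  simp [h]

theorem step_of_halted {s : Config k w} (hs : Halted prog s) (r : Sample) :
    step A prog r s = s := by
  unfold Halted at hs
  rw [step, hs]; rfl

theorem config_of_halted {ω : ℕ → Sample} {i : ℕ} (hs : Halted prog (config A prog w ω i))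
    (j : ℕ) : config A prog w ω (i + j) = config A prog w ω i := by
  induction j with
  | zero => rfl
  | succ j ih => rw [← add_assoc, config, ih, step_of_halted hs]

/-- A step reads one value from a finite range, so the integral is a finite average with positive
weights. Finiteness thus passes to every outcome, not just almost every one. -/
theorem step_ne_top {F : Config k w → ENNReal} {s : Config k w}
    (h : ∫⁻ r, F (step A prog r s) ∂sampleLaw ≠ ⊤) (r : Sample) : F (step A prog r s) ≠ ⊤ := by
  obtain ⟨m, g, hg⟩ := exists_step_eq A prog s
  simp only [hg] at h ⊢
  rw [lintegral_sampleLaw_eval m fun x => F (g x)] at h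
  intro h2
  refine h (ENNReal.sum_eq_top.2 ⟨r m, Finset.mem_univ _, ?_⟩)
  rw [h2]
  exact ENNReal.top_div_of_ne_top (by simp)

theorem post_of_expCost_ne_top (hq : 1 ≤ q) (ω : ℕ → Sample) (j i : ℕ)
    (h : expCost A prog post q j (config A prog w ω i) ≠ ⊤)
    (hh : Halted prog (config A prog w ω (i + j))) : post (config A prog w ω (i + j)) := by
  induction j generalizing i with
  | zero =>
    by_contra hp
    exact h (by simp only [expCost]; exact if_pos ⟨hh, hp⟩)
  | succ j ih =>
    by_cases hs : Halted prog (config A prog w ω i)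
    · rw [config_of_halted hs] at *
      by_contra hp
      exact h (by simp [expCost, hs, hp])
    · rw [expCost, if_neg hs] at h
      have h1 : ∫⁻ r, expCost A prog post q j (step A prog r (config A prog w ω i)) ∂sampleLaw
          ≠ ⊤ := fun h2 => h (by
        rw [h2]; exact ENNReal.mul_top (fun h0 => by simp [h0] at hq))
      have := ih (i + 1) (step_ne_top h1 (ω i)) (by rwa [add_assoc, add_comm 1 j])
      rwa [add_assoc, add_comm 1 j] at this

/-! ### Tail bound from the exponential cost. -/

open Classical in
/-- The probability of not having stopped after `t` further steps. -/
noncomputable def aliveProb (A : AdjArrays G d) (prog : List (Instr k)) : ℕ → Config k w → ENNReal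
  | 0, s => if Halted prog s then 0 else 1
  | t + 1, s => ∫⁻ r, aliveProb A prog t (step A prog r s) ∂sampleLaw

theorem aliveProb_of_halted {s : Config k w} (hs : Halted prog s) (t : ℕ) :
    aliveProb A prog t s = 0 := by
  induction t with
  | zero => simp [aliveProb, hs]
  | succ t ih => simp [aliveProb, step_of_halted hs, ih]

/-- Markov's inequality for `q ^ T`, by recursion along the run: each step of a running machine
contributes one factor `q` to both sides. -/
theorem pow_mul_aliveProb_le (t : ℕ) (s : Config k w) :
    q ^ t * aliveProb A prog t s ≤ expCost A prog post q t s := by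
  induction t generalizing s with
  | zero => by_cases hs : Halted prog s <;> simp [aliveProb, expCost, hs]
  | succ t ih =>
    by_cases hs : Halted prog s
    · rw [aliveProb_of_halted hs]; simp
    · obtain ⟨m, g, hg⟩ := exists_step_eq A prog s
      rw [aliveProb, expCost, if_neg hs, pow_succ', mul_assoc]
      gcongr
      simp only [hg]
      rw [lintegral_sampleLaw_eval m fun x => aliveProb A prog t (g x),
        lintegral_sampleLaw_eval m fun x => expCost A prog post q t (g x), Finset.mul_sum]
      refine Finset.sum_le_sum fun x _ => ?_
      rw [← mul_div_assoc]
      exact ENNReal.div_le_div_right (ih _) _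

theorem measurableSet_alive (A : AdjArrays G d) (prog : List (Instr k)) (w t : ℕ) :
    MeasurableSet {ω | ¬ Halted prog (config A prog w ω t)} :=
  have h : MeasurableSet {s : Config k w | ¬ Halted prog s} := trivial
  measurable_config A prog w t h

theorem lintegral_aliveProb (A : AdjArrays G d) (prog : List (Instr k)) (w j i : ℕ) :
    ∫⁻ ω, aliveProb A prog j (config A prog w ω i) ∂coins =
      coins {ω | ¬ Halted prog (config A prog w ω (i + j))} := by
  induction j generalizing i with
  | zero =>
    rw [← lintegral_indicator_one (measurableSet_alive A prog w (i + 0))]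
    refine lintegral_congr fun ω => ?_
    by_cases h : Halted prog (config A prog w ω i) <;> simp [aliveProb, Set.indicator, h]
  | succ j ih =>
    have := ih (i + 1)
    rw [lintegral_config_succ] at this
    rw [add_assoc, add_comm 1 j] at this
    exact this

theorem coins_alive_le (t : ℕ) :
    q ^ t * coins {ω | ¬ Halted prog (config A prog w ω t)} ≤
      expCost A prog post q t (init k w n d) := by
  have h := lintegral_aliveProb A prog w t 0
  simp only [config, lintegral_const, measure_univ, mul_one, zero_add] at h
  rw [← h]
  exact pow_mul_aliveProb_le t _

end ExpCost

end WordRAM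

namespace WordRAM

/-! ### Configurations given by natural numbers -/

section Conf

variable {k w n d : ℕ} {G : SimpleGraph (Fin n ⊕ Fin n)}

/-- The configuration whose registers and memory cells hold the given numbers, modulo `2 ^ w`. -/
def conf (w p : ℕ) (R : Fin k → ℕ) (M : ℕ → ℕ) : Config k w where
  pc := p
  reg i := BitVec.ofNat w (R i)
  mem a := BitVec.ofNat w (M a.toNat)

/-- The `i`-th neighbour of `u ∈ P` (`0` if an index is out of range). -/
def _root_.AdjArrays.nbr (A : AdjArrays G d) (u i : ℕ) : ℕ :=
  if h : u < n ∧ i < d then A.left ⟨u, h.1⟩ ⟨i, h.2⟩ else 0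

theorem conf_assign (p : ℕ) (R : Fin k → ℕ) (M : ℕ → ℕ) (dst : Fin k) (c : ℕ) :
    (conf w p R M).assign dst (BitVec.ofNat w c) = conf w (p + 1) (Function.update R dst c) M := by
  ext1
  · rfl
  · funext i
    by_cases h : i = dst
    · subst h; simp [Config.assign, conf]
    · simp [Config.assign, conf, h]
  · rfl

theorem conf_store (p : ℕ) (R : Fin k → ℕ) (M : ℕ → ℕ) {b : ℕ} (hb : b < 2 ^ w) (c : ℕ) :
    (⟨p, (conf w p R M).reg, Function.update (conf w p R M).mem (BitVec.ofNat w b)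
      (BitVec.ofNat w c)⟩ : Config k w) = conf w p R (Function.update M b c) := by
  ext1
  · rfl
  · rfl
  · funext i
    by_cases h : i = BitVec.ofNat w b
    · subst h; simp [conf, Nat.mod_eq_of_lt hb]
    · have : i.toNat ≠ b := by
        rintro rfl; exact h (by simp)
      simp [conf, h, this]

theorem ofNat_eq_ofNat_iff {a b : ℕ} (ha : a < 2 ^ w) (hb : b < 2 ^ w) :
    BitVec.ofNat w a = BitVec.ofNat w b ↔ a = b := by
  rw [← BitVec.toNat_inj]
  simp [Nat.mod_eq_of_lt ha, Nat.mod_eq_of_lt hb]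

variable {A : AdjArrays G d} {prog : List (Instr k)} {post : Config k w → Prop} {q x : ENNReal}
  {p c t : ℕ} {R : Fin k → ℕ} {M : ℕ → ℕ}

theorem step_conf {ins : Instr k} (hp : prog[p]? = some ins) (r : Sample) :
    step A prog r (conf w p R M) = exec A r (conf w p R M) ins := by
  simp [step, conf, hp]

theorem not_halted_conf {ins : Instr k} (hp : prog[p]? = some ins) (h : ins ≠ .halt) :
    ¬ Halted prog (conf w p R M) := by
  simp [Halted, conf, hp, h]

theorem expCost_succ_le_of_exec {ins : Instr k} (hp : prog[p]? = some ins) (hi : ins ≠ .halt)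
    {s' : Config k w} (hs : ∀ r, exec A r (conf w p R M) ins = s')
    (h : expCost A prog post q t s' ≤ q ^ c * x) :
    expCost A prog post q (t + 1) (conf w p R M) ≤ q ^ (c + 1) * x := by
  rw [expCost_succ_of_step (not_halted_conf hp hi) (s' := s')
    (fun r => by rw [step_conf hp, hs]), pow_succ', mul_assoc]
  gcongr

/-- The common form of the instruction rules below: an instruction takes one factor `q` off the
bound and leaves the cutoff `t` alone. -/
theorem expCost_le_of_exec (hq : 1 ≤ q) {ins : Instr k} (hp : prog[p]? = some ins)
    (hi : ins ≠ .halt) {s' : Config k w} (hs : ∀ r, exec A r (conf w p R M) ins = s')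
    (h : expCost A prog post q t s' ≤ q ^ c * x) :
    expCost A prog post q t (conf w p R M) ≤ q ^ (c + 1) * x :=
  (expCost_le_succ hq t _).trans (expCost_succ_le_of_exec hp hi hs h)

theorem expCost_const (hq : 1 ≤ q) {dst : Fin k} {a : ℕ} (hp : prog[p]? = some (.const dst a))
    (h : expCost A prog post q t (conf w (p + 1) (Function.update R dst a) M) ≤ q ^ c * x) :
    expCost A prog post q t (conf w p R M) ≤ q ^ (c + 1) * x :=
  expCost_le_of_exec hq hp (by simp) (fun _ => conf_assign ..) h

theorem expCost_move (hq : 1 ≤ q) {dst a : Fin k} (hp : prog[p]? = some (.move dst a))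
    (h : expCost A prog post q t (conf w (p + 1) (Function.update R dst (R a)) M) ≤ q ^ c * x) :
    expCost A prog post q t (conf w p R M) ≤ q ^ (c + 1) * x :=
  expCost_le_of_exec hq hp (by simp) (fun _ => conf_assign ..) h

theorem expCost_add (hq : 1 ≤ q) {dst a b : Fin k} (hp : prog[p]? = some (.add dst a b))
    (h : expCost A prog post q t (conf w (p + 1) (Function.update R dst (R a + R b)) M) ≤
      q ^ c * x) :
    expCost A prog post q t (conf w p R M) ≤ q ^ (c + 1) * x :=
  expCost_le_of_exec hq hp (by simp) (fun _ => by
    rw [← conf_assign, BitVec.ofNat_add]; rfl) h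

/-- Reduction modulo `2 ^ w` respects sums, but truncated subtraction only where it does not
truncate; hence `hab`. -/
theorem expCost_sub (hq : 1 ≤ q) {dst a b : Fin k} (hp : prog[p]? = some (.sub dst a b))
    (hab : R b ≤ R a)
    (h : expCost A prog post q t (conf w (p + 1) (Function.update R dst (R a - R b)) M) ≤
      q ^ c * x) :
    expCost A prog post q t (conf w p R M) ≤ q ^ (c + 1) * x :=
  expCost_le_of_exec hq hp (by simp) (fun _ => by
    have h2 : BitVec.ofNat w (R a - R b) = BitVec.ofNat w (R a) - BitVec.ofNat w (R b) := by
      conv_rhs => rw [← Nat.sub_add_cancel hab, BitVec.ofNat_add, BitVec.add_sub_cancel]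
    rw [← conf_assign, h2]; rfl) h

theorem expCost_div (hq : 1 ≤ q) {dst a b : Fin k} (hp : prog[p]? = some (.div dst a b))
    (ha : R a < 2 ^ w) (hb : R b < 2 ^ w)
    (h : expCost A prog post q t (conf w (p + 1) (Function.update R dst (R a / R b)) M) ≤
      q ^ c * x) :
    expCost A prog post q t (conf w p R M) ≤ q ^ (c + 1) * x :=
  expCost_le_of_exec hq hp (by simp) (fun _ => by
    have h2 : BitVec.ofNat w (R a / R b) =
        BitVec.udiv (BitVec.ofNat w (R a)) (BitVec.ofNat w (R b)) := by
      apply BitVec.eq_of_toNat_eq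
      change _ = (BitVec.ofNat w (R a) / BitVec.ofNat w (R b)).toNat
      rw [BitVec.toNat_udiv]
      simp [Nat.mod_eq_of_lt ha, Nat.mod_eq_of_lt hb,
        Nat.mod_eq_of_lt ((Nat.div_le_self (R a) (R b)).trans_lt ha)]
    rw [← conf_assign, h2]; rfl) h

theorem expCost_load (hq : 1 ≤ q) {dst a : Fin k} (hp : prog[p]? = some (.load dst a))
    (ha : R a < 2 ^ w)
    (h : expCost A prog post q t (conf w (p + 1) (Function.update R dst (M (R a))) M) ≤
      q ^ c * x) :
    expCost A prog post q t (conf w p R M) ≤ q ^ (c + 1) * x :=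
  expCost_le_of_exec hq hp (by simp) (fun _ => by
    rw [← conf_assign]
    simp [exec, conf, Nat.mod_eq_of_lt ha]) h

theorem expCost_store (hq : 1 ≤ q) {b a : Fin k} (hp : prog[p]? = some (.store b a))
    (hb : R b < 2 ^ w)
    (h : expCost A prog post q t (conf w (p + 1) R (Function.update M (R b) (R a))) ≤
      q ^ c * x) :
    expCost A prog post q t (conf w p R M) ≤ q ^ (c + 1) * x :=
  expCost_le_of_exec hq hp (by simp) (fun _ => by rw [← conf_store _ _ _ hb]; rfl) h

theorem expCost_nbrLeft (hq : 1 ≤ q) {dst u i : Fin k} (hp : prog[p]? = some (.nbrLeft dst u i))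
    (hu : R u < 2 ^ w) (hi : R i < 2 ^ w)
    (h : expCost A prog post q t
      (conf w (p + 1) (Function.update R dst (A.nbr (R u) (R i))) M) ≤ q ^ c * x) :
    expCost A prog post q t (conf w p R M) ≤ q ^ (c + 1) * x :=
  expCost_le_of_exec hq hp (by simp) (fun _ => by
    rw [← conf_assign, exec]
    congr 1
    unfold lookup AdjArrays.nbr
    simp only [conf, BitVec.toNat_ofNat, Nat.mod_eq_of_lt hu, Nat.mod_eq_of_lt hi]
    split_ifs <;> rfl) h

theorem expCost_jump (hq : 1 ≤ q) {l : ℕ} (hp : prog[p]? = some (.jump l))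
    (h : expCost A prog post q t (conf w l R M) ≤ q ^ c * x) :
    expCost A prog post q t (conf w p R M) ≤ q ^ (c + 1) * x :=
  expCost_le_of_exec hq hp (by simp) (fun _ => rfl) h

theorem exec_jumpEq {a b : Fin k} {l : ℕ} (ha : R a < 2 ^ w) (hb : R b < 2 ^ w) (r : Sample) :
    exec A r (conf w p R M) (.jumpEq a b l) = conf w (if R a = R b then l else p + 1) R M := by
  simp only [exec, conf, ofNat_eq_ofNat_iff ha hb]

theorem expCost_jumpEq (hq : 1 ≤ q) {a b : Fin k} {l : ℕ} (hp : prog[p]? = some (.jumpEq a b l))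
    (ha : R a < 2 ^ w) (hb : R b < 2 ^ w)
    (h : expCost A prog post q t (conf w (if R a = R b then l else p + 1) R M) ≤ q ^ c * x) :
    expCost A prog post q t (conf w p R M) ≤ q ^ (c + 1) * x :=
  expCost_le_of_exec hq hp (by simp) (fun _ => exec_jumpEq ha hb _) h

/-- The cost is averaged over the draw; the premise is multiplied by the size of the range to avoid
division in `ENNReal`. -/
theorem expCost_rand (hq : 1 ≤ q) {dst a : Fin k} (hp : prog[p]? = some (.rand dst a))
    (ha : R a < 2 ^ w) (ha0 : 0 < R a)
    (h : ∑ i ∈ Finset.range (R a),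
      expCost A prog post q t (conf w (p + 1) (Function.update R dst i) M) ≤ q ^ c * (R a * x)) :
    expCost A prog post q t (conf w p R M) ≤ q ^ (c + 1) * x := by
  refine (expCost_le_succ hq t _).trans ?_
  rw [expCost, if_neg (not_halted_conf hp (by simp)), pow_succ', mul_assoc]
  gcongr
  obtain ⟨m, hm⟩ : ∃ m, R a = m + 1 := ⟨R a - 1, by omega⟩
  have hs (r : Sample) : step A prog r (conf w p R M) =
      conf w (p + 1) (Function.update R dst (r m)) M := by
    have h2 : (BitVec.ofNat w (R a)).toNat - 1 = m := by
      rw [BitVec.toNat_ofNat, Nat.mod_eq_of_lt ha, hm, Nat.add_sub_cancel]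
    rw [step_conf hp, ← conf_assign]
    change (conf w p R M).assign dst
      (BitVec.ofNat w (r ((BitVec.ofNat w (R a)).toNat - 1))) = _
    rw [h2]
  simp only [hs]
  rw [lintegral_sampleLaw_eval m
    fun i => expCost A prog post q t (conf w (p + 1) (Function.update R dst i) M)]
  rw [hm] at h
  simp only [div_eq_mul_inv]
  rw [← Finset.sum_mul, ← Finset.sum_range
    fun i => expCost A prog post q t (conf w (p + 1) (Function.update R dst i) M),
    ← div_eq_mul_inv]
  refine ENNReal.div_le_of_le_mul' (h.trans_eq ?_)
  ring

end Conf

end WordRAM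

/-! ### Partial matchings and the random walk -/

namespace AdjArrays

variable {n d : ℕ} {G : SimpleGraph (Fin n ⊕ Fin n)} (A : AdjArrays G d)

theorem nbr_lt {u i : ℕ} (hu : u < n) (hi : i < d) : A.nbr u i < n := by
  rw [nbr, dif_pos ⟨hu, hi⟩]; exact Fin.isLt _

theorem degree_le (A : AdjArrays G d) (hn : 1 ≤ n) : d ≤ n := by
  simpa using Fintype.card_le_of_injective _ (A.left_injective ⟨0, hn⟩)

/-- Double counting of edges, where regularity on the side of `Q` enters. -/
theorem sum_nbr (F : ℕ → ENNReal) :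
    ∑ u ∈ Finset.range n, ∑ i ∈ Finset.range d, F (A.nbr u i) =
      d * ∑ v ∈ Finset.range n, F v := by
  classical
  have h1 (u : Fin n) : ∑ i ∈ Finset.range d, F (A.nbr u i) =
      ∑ v : Fin n, if G.Adj (Sum.inl u) (Sum.inr v) then F v else 0 := by
    rw [Finset.sum_range, ← Finset.sum_filter]
    have : Finset.univ.filter (fun v => G.Adj (Sum.inl u) (Sum.inr v)) =
        Finset.univ.image (A.left u) := by
      ext v; simp [A.adj_iff_left]
    rw [this, Finset.sum_image fun i _ j _ h => A.left_injective u h]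
    simp [nbr]
  have h2 (v : Fin n) :
      ∑ u : Fin n, (if G.Adj (Sum.inl u) (Sum.inr v) then F v else 0) = d * F v := by
    rw [← Finset.sum_filter, Finset.sum_const]
    have : Finset.univ.filter (fun u => G.Adj (Sum.inl u) (Sum.inr v)) =
        Finset.univ.image (A.right v) := by
      ext u; simp [A.adj_iff_right]
    rw [this, Finset.card_image_of_injective _ (A.right_injective v)]
    simp
  rw [Finset.sum_range, Finset.sum_range]
  simp only [h1]
  rw [Finset.sum_comm, Finset.mul_sum]
  exact Finset.sum_congr rfl fun v _ => h2 v

/-- `mate` is a partial matching (`mate v` is `0` if `v ∈ Q` is unmatched and `u + 1` if it is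
matched to `u`), `free` lists `k` vertices of `P` that it does not match, and `z` vertices of `Q`
are unmatched. -/
structure PartialMatching (mate free : ℕ → ℕ) (k z : ℕ) : Prop where
  edge : ∀ v < n, mate v ≠ 0 → mate v ≤ n ∧ ∃ i < d, A.nbr (mate v - 1) i = v
  inj : ∀ v < n, ∀ v' < n, mate v ≠ 0 → mate v = mate v' → v = v'
  free_lt : ∀ i < k, free i < n
  free_inj : ∀ i < k, ∀ j < k, free i = free j → i = j
  free_unmatched : ∀ i < k, ∀ v < n, mate v ≠ free i + 1
  card : ((Finset.range n).filter fun v => mate v = 0).card = z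

/-- The probability that a random walk from `u ∈ P`, which repeatedly moves to a random neighbour
and on to its mate, takes `b` moves without meeting an unmatched vertex. -/
noncomputable def survival (mate : ℕ → ℕ) : ℕ → ℕ → ENNReal
  | 0, _ => 1
  | b + 1, u => (∑ i ∈ Finset.range d,
      if mate (A.nbr u i) = 0 then 0 else survival mate b (mate (A.nbr u i) - 1)) / d

variable {A} {mate free : ℕ → ℕ} {k z : ℕ}

theorem survival_succ_le (hd : 1 ≤ d) (b u : ℕ) :
    A.survival mate (b + 1) u ≤ A.survival mate b u := by
  have hd0 : (d : ENNReal) ≠ 0 := by simp; omega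
  induction b generalizing u with
  | zero =>
    rw [survival, survival]
    refine ENNReal.div_le_of_le_mul' ?_
    calc _ ≤ ∑ _i ∈ Finset.range d, (1 : ENNReal) := by
          refine Finset.sum_le_sum fun i _ => ?_
          split_ifs <;> simp [survival]
      _ = _ := by simp
  | succ b ih =>
    rw [survival, survival]
    refine ENNReal.div_le_div_right (Finset.sum_le_sum fun i _ => ?_) _
    split_ifs
    · exact le_rfl
    · exact ih _

theorem survival_anti (hd : 1 ≤ d) (u : ℕ) : Antitone fun b => A.survival mate b u :=
  antitone_nat_of_succ_le fun b => survival_succ_le hd b u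

namespace PartialMatching

theorem congr (h : A.PartialMatching mate free k z) {mate' free' : ℕ → ℕ}
    (hm : ∀ v < n, mate' v = mate v) (hf : ∀ i < k, free' i = free i) :
    A.PartialMatching mate' free' k z where
  edge v hv := by rw [hm v hv]; exact h.edge v hv
  inj v hv v' hv' := by rw [hm v hv, hm v' hv']; exact h.inj v hv v' hv'
  free_lt i hi := by rw [hf i hi]; exact h.free_lt i hi
  free_inj i hi j hj := by rw [hf i hi, hf j hj]; exact h.free_inj i hi j hj
  free_unmatched i hi v hv := by rw [hf i hi, hm v hv]; exact h.free_unmatched i hi v hv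
  card := by
    rw [← h.card]
    congr 1
    refine Finset.filter_congr fun v hv => ?_
    rw [hm v (Finset.mem_range.1 hv)]

theorem mate_ne_zero (h : A.PartialMatching mate free k 0) {v : ℕ} (hv : v < n) : mate v ≠ 0 := by
  intro hv0
  have h2 := Finset.card_eq_zero.1 h.card
  rw [Finset.filter_eq_empty_iff] at h2
  exact h2 (Finset.mem_range.2 hv) hv0

theorem le (h : A.PartialMatching mate free k z) : z ≤ n := by
  rw [← h.card]
  exact (Finset.card_filter_le _ _).trans_eq (Finset.card_range n)

/-- By `sum_nbr`, averaging over neighbours turns the sum of `survival (b + 1)` over `P` into that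
of `survival b` over the mates of matched vertices of `Q`. These mates are distinct and disjoint
from the list `free`. -/
theorem sum_survival_free_add_le (h : A.PartialMatching mate free k z) (hd : 1 ≤ d) (b : ℕ) :
    ∑ i ∈ Finset.range k, A.survival mate b (free i) +
      ∑ u ∈ Finset.range n, A.survival mate (b + 1) u ≤
      ∑ u ∈ Finset.range n, A.survival mate b u := by
  classical
  have hd0 : (d : ENNReal) ≠ 0 := by simp; omega
  have h1 : ∑ u ∈ Finset.range n, A.survival mate (b + 1) u =
      ∑ v ∈ (Finset.range n).filter (fun v => mate v ≠ 0), A.survival mate b (mate v - 1) := by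
    simp only [survival]
    simp only [div_eq_mul_inv]
    rw [← Finset.sum_mul, A.sum_nbr fun v => if mate v = 0 then 0 else
      A.survival mate b (mate v - 1), mul_comm, ← mul_assoc,
      ENNReal.inv_mul_cancel hd0 (ENNReal.natCast_ne_top d), one_mul, Finset.sum_filter]
    refine Finset.sum_congr rfl fun v _ => ?_
    by_cases hv : mate v = 0 <;> simp [hv]
  have h2 : ∑ i ∈ Finset.range k, A.survival mate b (free i) =
      ∑ u ∈ (Finset.range k).image free, A.survival mate b u := by
    rw [Finset.sum_image fun i hi j hj => h.free_inj i (by simpa using hi) j (by simpa using hj)]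
  have h3 : ∑ v ∈ (Finset.range n).filter (fun v => mate v ≠ 0), A.survival mate b (mate v - 1) =
      ∑ u ∈ ((Finset.range n).filter (fun v => mate v ≠ 0)).image (fun v => mate v - 1),
        A.survival mate b u := by
    rw [Finset.sum_image]
    intro v hv v' hv' hvv
    simp only [Finset.coe_filter, Finset.mem_range, Set.mem_ofPred_eq] at hv hv'
    exact h.inj v hv.1 v' hv'.1 hv.2 (by dsimp only at hvv; omega)
  rw [h1, h2, h3, ← Finset.sum_union]
  · refine Finset.sum_le_sum_of_subset fun u hu => ?_
    simp only [Finset.mem_union, Finset.mem_image, Finset.mem_range, Finset.mem_filter] at hu ⊢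
    obtain ⟨i, hi, rfl⟩ | ⟨v, ⟨hv, hv0⟩, rfl⟩ := hu
    · exact h.free_lt i hi
    · have := (h.edge v hv hv0).1
      omega
  · rw [Finset.disjoint_left]
    intro u hu hu'
    simp only [Finset.mem_image, Finset.mem_range, Finset.mem_filter] at hu hu'
    obtain ⟨i, hi, rfl⟩ := hu
    obtain ⟨v, ⟨hv, hv0⟩, hvi⟩ := hu'
    exact h.free_unmatched i hi v hv (by omega)

/-- The preceding inequality telescopes, starting from the total `n` for zero moves; survival
decreases with the number of moves, so the last of the `b` summands is the smallest. -/
theorem mul_sum_survival_free_le (h : A.PartialMatching mate free k z) (hd : 1 ≤ d) (b : ℕ) :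
    b * ∑ i ∈ Finset.range k, A.survival mate b (free i) ≤ n := by
  have h1 (m : ℕ) : ∑ t ∈ Finset.range m, ∑ i ∈ Finset.range k, A.survival mate t (free i) +
      ∑ u ∈ Finset.range n, A.survival mate m u ≤ n := by
    induction m with
    | zero => simp [survival]
    | succ m ih =>
      rw [Finset.sum_range_succ, add_assoc]
      exact (by gcongr; exact h.sum_survival_free_add_le hd m : _ ≤ _).trans ih
  refine le_trans ?_ (le_self_add.trans (h1 b))
  rw [← nsmul_eq_mul]
  calc b • ∑ i ∈ Finset.range k, A.survival mate b (free i)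
      = ∑ _t ∈ Finset.range b, ∑ i ∈ Finset.range k, A.survival mate b (free i) := by simp
    _ ≤ _ := Finset.sum_le_sum fun t ht => Finset.sum_le_sum fun i _ =>
        survival_anti hd _ (Finset.mem_range.1 ht).le

/-- Matching one more vertex `v`, along an edge from an unmatched vertex `u`. -/
theorem augment (h : A.PartialMatching mate free k (z + 1)) {u v : ℕ} (hu : u < n) (hv : v < n)
    (huf : ∀ i < k, free i ≠ u) (hum : ∀ v < n, mate v ≠ u + 1) (he : ∃ i < d, A.nbr u i = v)
    (hv0 : mate v = 0) : A.PartialMatching (Function.update mate v (u + 1)) free k z where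
  edge x hx := by
    by_cases hxv : x = v
    · subst hxv; simpa using ⟨hu, he⟩
    · simpa [hxv] using h.edge x hx
  inj x hx y hy := by
    by_cases hxv : x = v <;> by_cases hyv : y = v
    · simp [hxv, hyv]
    · subst hxv; simp only [Function.update_self, Function.update_of_ne hyv]
      exact fun _ h => absurd h.symm (hum y hy)
    · subst hyv; simp only [Function.update_self, Function.update_of_ne hxv]
      exact fun _ h => absurd h (hum x hx)
    · simpa [hxv, hyv] using h.inj x hx y hy
  free_lt := h.free_lt
  free_inj := h.free_inj
  free_unmatched i hi x hx := by
    by_cases hxv : x = v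
    · subst hxv; simpa using (huf i hi).symm
    · simpa [hxv] using h.free_unmatched i hi x hx
  card := by
    have h2 : (Finset.range n).filter (fun x => Function.update mate v (u + 1) x = 0) =
        ((Finset.range n).filter fun x => mate x = 0).erase v := by
      ext x
      by_cases hxv : x = v <;> simp [hxv]
    rw [h2, Finset.card_erase_of_mem (by simp [hv, hv0]), h.card, Nat.add_sub_cancel]

/-- Matching `v` to an unmatched vertex `u` instead of its previous mate. -/
theorem rotate (h : A.PartialMatching mate free k z) {u v : ℕ} (hu : u < n)
    (huf : ∀ i < k, free i ≠ u) (hum : ∀ v < n, mate v ≠ u + 1) (he : ∃ i < d, A.nbr u i = v)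
    (hv0 : mate v ≠ 0) : A.PartialMatching (Function.update mate v (u + 1)) free k z where
  edge x hx := by
    by_cases hxv : x = v
    · subst hxv; simpa using ⟨hu, he⟩
    · simpa [hxv] using h.edge x hx
  inj x hx y hy := by
    by_cases hxv : x = v <;> by_cases hyv : y = v
    · simp [hxv, hyv]
    · subst hxv; simp only [Function.update_self, Function.update_of_ne hyv]
      exact fun _ h => absurd h.symm (hum y hy)
    · subst hyv; simp only [Function.update_self, Function.update_of_ne hxv]
      exact fun _ h => absurd h (hum x hx)
    · simpa [hxv, hyv] using h.inj x hx y hy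
  free_lt := h.free_lt
  free_inj := h.free_inj
  free_unmatched i hi x hx := by
    by_cases hxv : x = v
    · subst hxv; simpa using (huf i hi).symm
    · simpa [hxv] using h.free_unmatched i hi x hx
  card := by
    rw [← h.card]
    congr 1
    refine Finset.filter_congr fun x _ => ?_
    by_cases hxv : x = v
    · subst hxv; simp [hv0]
    · simp [hxv]

/-- Removing an entry of the list of unmatched vertices. -/
theorem remove (h : A.PartialMatching mate free (k + 1) z) {i : ℕ} (hi : i ≤ k) :
    A.PartialMatching mate (Function.update free i (free k)) k z ∧
      ∀ j < k, Function.update free i (free k) j ≠ free i := by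
  -- The last entry fills the hole at `i`; each new entry comes from its own old index `l`,
  -- different from `i`.
  have key (j : ℕ) (hj : j < k) : ∃ l < k + 1, l ≠ i ∧ (j = i ∧ l = k ∨ j ≠ i ∧ l = j) ∧
      Function.update free i (free k) j = free l := by
    by_cases hji : j = i
    · exact ⟨k, by omega, by omega, by omega, by simp [hji]⟩
    · exact ⟨j, by omega, hji, by omega, by simp [hji]⟩
  refine ⟨⟨h.edge, h.inj, fun j hj => ?_, fun j hj j' hj' hjj => ?_, fun j hj => ?_, h.card⟩,
    fun j hj => ?_⟩
  · obtain ⟨l, hl, -, -, hl'⟩ := key j hj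
    rw [hl']; exact h.free_lt l hl
  · obtain ⟨l, hl, -, hlj, hl'⟩ := key j hj
    obtain ⟨m, hm, -, hmj, hm'⟩ := key j' hj'
    rw [hl', hm'] at hjj
    have := h.free_inj l hl m hm hjj
    omega
  · obtain ⟨l, hl, -, -, hl'⟩ := key j hj
    rw [hl']; exact h.free_unmatched l hl
  · obtain ⟨l, hl, hli, -, hl'⟩ := key j hj
    rw [hl']
    exact fun he => hli (h.free_inj l hl i (by omega) he)

end PartialMatching

/-! ### Loop-erased walks and augmentation. -/

/-- `nxt` describes an alternating path from `u` to `x`, with `j` matched edges. -/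
def ExitPath (A : AdjArrays G d) (mate nxt : ℕ → ℕ) (j u x : ℕ) : Prop :=
  ∃ p : ℕ → ℕ, p 0 = u ∧ p j = x ∧ (∀ i ≤ j, p i < n) ∧
    (∀ i ≤ j, ∀ i' ≤ j, p i = p i' → i = i') ∧
    ∀ i < j, (∃ l < d, A.nbr (p i) l = nxt (p i)) ∧ mate (nxt (p i)) = p (i + 1) + 1

theorem ExitPath.refl {nxt : ℕ → ℕ} {u : ℕ} (hu : u < n) : A.ExitPath mate nxt 0 u u :=
  ⟨fun _ => u, rfl, rfl, fun _ _ => hu, fun i hi i' hi' _ => by omega, fun i hi => by omega⟩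

theorem ExitPath.lt {nxt : ℕ → ℕ} {j u x : ℕ} (h : A.ExitPath mate nxt j u x) : x < n := by
  obtain ⟨p, -, rfl, hp, -⟩ := h
  exact hp _ le_rfl

theorem ExitPath.congr {nxt nxt' mate' : ℕ → ℕ} {j u x : ℕ} (h : A.ExitPath mate nxt j u x)
    (hm : ∀ v < n, mate' v = mate v) (hx : ∀ u < n, nxt' u = nxt u) :
    A.ExitPath mate' nxt' j u x := by
  obtain ⟨p, h0, hj, hp, hinj, he⟩ := h
  refine ⟨p, h0, hj, hp, hinj, fun i hi => ?_⟩
  obtain ⟨⟨l, hl, hl'⟩, h2⟩ := he i hi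
  have := A.nbr_lt (hp i hi.le) hl
  rw [hx _ (hp i hi.le), hm _ (hl' ▸ this)]
  exact ⟨⟨l, hl, hl'⟩, h2⟩

/-- Last-exit pointers erase loops for free. If `y` is already on the path, the path is cut there;
otherwise it grows by one edge. Overwriting the pointer of the endpoint `x` is harmless, as earlier
path vertices differ from `x`. -/
theorem ExitPath.extend {nxt : ℕ → ℕ} {j u x l y : ℕ} (h : A.ExitPath mate nxt j u x) (hl : l < d)
    (hy : y < n) (hm : mate (A.nbr x l) = y + 1) :
    ∃ j' ≤ j + 1, A.ExitPath mate (Function.update nxt x (A.nbr x l)) j' u y := by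
  obtain ⟨p, h0, hj, hp, hinj, he⟩ := h
  have hne (i : ℕ) (hi : i < j) : p i ≠ x := fun h => by
    have := hinj i hi.le j le_rfl (h.trans hj.symm)
    omega
  by_cases hex : ∃ i ≤ j, p i = y
  · obtain ⟨i, hi, hpi⟩ := hex
    refine ⟨i, by omega, p, h0, hpi, fun a ha => hp a (by omega),
      fun a ha b hb => hinj a (by omega) b (by omega), fun a ha => ?_⟩
    rw [Function.update_of_ne (hne a (by omega))]
    exact he a (by omega)
  · push Not at hex
    refine ⟨j + 1, le_rfl, fun i => if i = j + 1 then y else p i, by simpa using h0, by simp,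
      fun a ha => ?_, fun a ha b hb => ?_, fun a ha => ?_⟩
    · dsimp only
      split_ifs
      · exact hy
      · exact hp a (by omega)
    · dsimp only
      split_ifs with h1 h2 h2
      · omega
      · exact fun h => absurd h.symm (hex b (by omega))
      · exact fun h => absurd h (hex a (by omega))
      · exact hinj a (by omega) b (by omega)
    · simp only [if_neg (show a ≠ j + 1 by omega), add_left_inj]
      by_cases haj : a = j
      · subst haj
        simp only [hj, Function.update_self, if_true, hm, and_true]
        exact ⟨l, hl, rfl⟩
      · rw [if_neg haj, Function.update_of_ne (hne a (by omega))]
        exact he a (by omega)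

/-- An alternating path described by `nxt` leads from `u` to an unmatched vertex of `Q`; `u` is
unmatched and not listed by `free`. -/
structure Augmenting (A : AdjArrays G d) (mate free nxt : ℕ → ℕ) (k z j u : ℕ) : Prop where
  matching : A.PartialMatching mate free k z
  notMem : ∀ i < k, free i ≠ u
  unmatched : ∀ v < n, mate v ≠ u + 1
  path : ∃ x, A.ExitPath mate nxt j u x ∧ (∃ l < d, A.nbr x l = nxt x) ∧ mate (nxt x) = 0

namespace Augmenting

variable {nxt : ℕ → ℕ} {j u : ℕ}

theorem congr (h : A.Augmenting mate free nxt k z j u) {mate' free' nxt' : ℕ → ℕ}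
    (hm : ∀ v < n, mate' v = mate v) (hf : ∀ i < k, free' i = free i)
    (hx : ∀ u < n, nxt' u = nxt u) : A.Augmenting mate' free' nxt' k z j u where
  matching := h.matching.congr hm hf
  notMem i hi := by rw [hf i hi]; exact h.notMem i hi
  unmatched v hv := by rw [hm v hv]; exact h.unmatched v hv
  path := by
    obtain ⟨x, hp, ⟨l, hl, hl'⟩, h0⟩ := h.path
    have := A.nbr_lt hp.lt hl
    refine ⟨x, hp.congr hm hx, ?_, ?_⟩
    · rw [hx x hp.lt]; exact ⟨l, hl, hl'⟩
    · rw [hx x hp.lt, hm _ (hl' ▸ this)]; exact h0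

theorem lt (h : A.Augmenting mate free nxt k z j u) : u < n := by
  obtain ⟨x, ⟨p, rfl, -, hp, -⟩, -⟩ := h.path
  exact hp 0 (by omega)

theorem exists_edge (h : A.Augmenting mate free nxt k z j u) : ∃ l < d, A.nbr u l = nxt u := by
  obtain ⟨x, ⟨p, h0, hj, hp, hinj, he⟩, hx, hx0⟩ := h.path
  rcases Nat.eq_zero_or_pos j with rfl | hj0
  · rwa [← h0, hj]
  · rw [← h0]; exact (he 0 hj0).1

theorem nxt_lt (h : A.Augmenting mate free nxt k z j u) : nxt u < n := by
  obtain ⟨l, hl, hl'⟩ := h.exists_edge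
  rw [← hl']; exact A.nbr_lt h.lt hl

theorem finish (h : A.Augmenting mate free nxt k (z + 1) j u) (h0 : mate (nxt u) = 0) :
    A.PartialMatching (Function.update mate (nxt u) (u + 1)) free k z :=
  h.matching.augment h.lt h.nxt_lt h.notMem h.unmatched h.exists_edge h0

/-- Taking the first edge of the path into the matching frees the next path vertex, from which the
remaining path, shorter by one, is still augmenting. -/
theorem rotate (h : A.Augmenting mate free nxt k z j u) (h0 : mate (nxt u) ≠ 0) :
    ∃ j', j = j' + 1 ∧ A.Augmenting (Function.update mate (nxt u) (u + 1)) free nxt k z j'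
      (mate (nxt u) - 1) := by
  have hun := h.nxt_lt
  obtain ⟨x, ⟨p, hp0, hpj, hp, hinj, he⟩, ⟨l, hl, hlx⟩, hx0⟩ := h.path
  obtain ⟨j, rfl⟩ : ∃ j', j = j' + 1 := by
    rcases j with _ | j
    · rw [← hp0, hpj] at h0; exact absurd hx0 h0
    · exact ⟨j, rfl⟩
  have hm1 : mate (nxt u) = p 1 + 1 := by rw [← hp0]; exact (he 0 (by omega)).2
  refine ⟨j, rfl, h.matching.rotate h.lt h.notMem h.unmatched h.exists_edge h0,
    fun i hi heq => ?_, fun v hv => ?_,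
    x, ⟨fun i => p (i + 1), by simp [hm1], hpj, fun i hi => hp _ (by omega),
      fun i hi i' hi' hii => ?_, fun i hi => ⟨(he (i + 1) (by omega)).1, ?_⟩⟩, ⟨l, hl, hlx⟩, ?_⟩
  · exact h.matching.free_unmatched i hi _ hun (by omega)
  · by_cases hvu : v = nxt u
    · subst hvu
      have h01 : p 0 ≠ p 1 := fun h => by
        have := hinj 0 (by omega) 1 (by omega) h
        omega
      rw [Function.update_self, hm1]
      omega
    · rw [Function.update_of_ne hvu]
      intro hv2
      exact hvu (h.matching.inj v hv _ hun (by omega) (by omega))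
  · have := hinj _ (by omega) _ (by omega) hii
    omega
  -- The changed entry of `mate` is not used later: otherwise its old mate would be both `p 1` and
  -- `p (i + 2)`, but path vertices are distinct.
  · have h2 := (he (i + 1) (by omega)).2
    rw [Function.update_of_ne, h2]
    intro h3
    rw [h3, hm1] at h2
    have := hinj 1 (by omega) (i + 1 + 1) (by omega) (by omega)
    omega
  · rw [Function.update_of_ne, hx0]
    intro h3
    rw [h3] at hx0
    exact h0 hx0

end Augmenting

end AdjArrays

namespace WordRAM

/-! ### The program -/

/-- The program. Cell `n + v` holds the mate of `v ∈ Q` plus one, the cells from `2 * n` on list the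
unmatched vertices of `P`, and cell `u` holds the vertex by which the random walk left `u ∈ P`
for the last time. -/
def matchingProgram : List (Instr 13) :=
  [.const 3 1, .add 4 0 0,
    -- List all vertices of `P` as unmatched.
    .jumpEq 5 0 7, .add 6 4 5, .store 6 5, .add 5 5 3, .jump 2, .move 7 0,
    -- Choose the length of the walk and a random unmatched vertex.
    .jumpEq 7 2 38, .div 8 0 7, .add 8 8 3, .add 8 8 8, .rand 5 7, .add 6 4 5, .load 9 6,
    .move 10 9,
    -- Walk.
    .jumpEq 8 2 8, .sub 8 8 3, .rand 5 1, .nbrLeft 11 10 5, .store 10 11, .add 12 0 11,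
    .load 10 12, .jumpEq 10 2 26, .sub 10 10 3, .jump 16,
    -- Remove the start of the walk from the list.
    .sub 7 7 3, .add 12 4 7, .load 12 12, .store 6 12,
    -- Augment.
    .load 11 9, .add 12 0 11, .load 10 12, .add 9 9 3, .store 12 9, .jumpEq 10 2 8, .sub 9 10 3,
    .jump 30,
    -- Write the output.
    .move 5 2, .jumpEq 5 0 46, .add 12 0 5, .load 10 12, .sub 10 10 3, .store 10 5, .add 5 5 3,
    .jump 39, .halt]

/-- The contents of the registers. -/
def regs (n d z o l i a k b u x v y : ℕ) : Fin 13 → ℕ := ![n, d, z, o, l, i, a, k, b, u, x, v, y]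

theorem regs_update (n d z o l i a k b u x v y c : ℕ) :
    Function.update (regs n d z o l i a k b u x v y) 0 c =
      regs c d z o l i a k b u x v y ∧
    Function.update (regs n d z o l i a k b u x v y) 1 c =
      regs n c z o l i a k b u x v y ∧
    Function.update (regs n d z o l i a k b u x v y) 2 c =
      regs n d c o l i a k b u x v y ∧
    Function.update (regs n d z o l i a k b u x v y) 3 c =
      regs n d z c l i a k b u x v y ∧
    Function.update (regs n d z o l i a k b u x v y) 4 c =
      regs n d z o c i a k b u x v y ∧
    Function.update (regs n d z o l i a k b u x v y) 5 c =
      regs n d z o l c a k b u x v y ∧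
    Function.update (regs n d z o l i a k b u x v y) 6 c =
      regs n d z o l i c k b u x v y ∧
    Function.update (regs n d z o l i a k b u x v y) 7 c =
      regs n d z o l i a c b u x v y ∧
    Function.update (regs n d z o l i a k b u x v y) 8 c =
      regs n d z o l i a k c u x v y ∧
    Function.update (regs n d z o l i a k b u x v y) 9 c =
      regs n d z o l i a k b c x v y ∧
    Function.update (regs n d z o l i a k b u x v y) 10 c =
      regs n d z o l i a k b u c v y ∧
    Function.update (regs n d z o l i a k b u x v y) 11 c =
      regs n d z o l i a k b u x c y ∧
    Function.update (regs n d z o l i a k b u x v y) 12 c =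
      regs n d z o l i a k b u x v c := by
  refine ⟨?_, ?_, ?_, ?_, ?_, ?_, ?_, ?_, ?_, ?_, ?_, ?_, ?_⟩ <;>
  · funext j
    fin_cases j <;> rfl

theorem regs_apply (n d z o l i a k b u x v y : ℕ) :
    regs n d z o l i a k b u x v y 0 = n ∧
    regs n d z o l i a k b u x v y 1 = d ∧
    regs n d z o l i a k b u x v y 2 = z ∧
    regs n d z o l i a k b u x v y 3 = o ∧
    regs n d z o l i a k b u x v y 4 = l ∧
    regs n d z o l i a k b u x v y 5 = i ∧
    regs n d z o l i a k b u x v y 6 = a ∧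
    regs n d z o l i a k b u x v y 7 = k ∧
    regs n d z o l i a k b u x v y 8 = b ∧
    regs n d z o l i a k b u x v y 9 = u ∧
    regs n d z o l i a k b u x v y 10 = x ∧
    regs n d z o l i a k b u x v y 11 = v ∧
    regs n d z o l i a k b u x v y 12 = y :=
  ⟨rfl, rfl, rfl, rfl, rfl, rfl, rfl, rfl, rfl, rfl, rfl, rfl, rfl⟩

/-! ### Cost and correctness of the program's loops. -/

section Program

variable {n d : ℕ} {G : SimpleGraph (Fin n ⊕ Fin n)} {A : AdjArrays G d} {w : ℕ} {q K : ENNReal}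

/-- The exponential cost of the program from a configuration given by natural numbers. -/
noncomputable abbrev cost (A : AdjArrays G d) (w : ℕ) (q : ENNReal) (t p : ℕ) (R : Fin 13 → ℕ)
    (M : ℕ → ℕ) : ENNReal :=
  expCost A matchingProgram (fun s => EncodesPerfectMatching G s.mem) q t (conf w p R M)

theorem adj_of_nbr {u v : ℕ} (hu : u < n) (hv : v < n) (h : ∃ i < d, A.nbr u i = v) :
    G.Adj (Sum.inl ⟨u, hu⟩) (Sum.inr ⟨v, hv⟩) := by
  obtain ⟨i, hi, h⟩ := h
  rw [A.adj_iff_left]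
  refine ⟨⟨i, hi⟩, ?_⟩
  rw [AdjArrays.nbr, dif_pos ⟨hu, hi⟩] at h
  exact Fin.ext h

theorem encodesPerfectMatching_of_bijective {σ : Fin n → Fin n} (hσ : Function.Bijective σ)
    (hadj : ∀ v, G.Adj (Sum.inl (σ v)) (Sum.inr v)) (hn : n ≤ 2 ^ w) {M : ℕ → ℕ}
    (hM : ∀ v, M (σ v) = v) (R : Fin 13 → ℕ) (p : ℕ) :
    EncodesPerfectMatching G (conf w p R M).mem := by
  let S : G.Subgraph :=
    { verts := Set.univ
      Adj := fun a b => ∃ v, (a = Sum.inl (σ v) ∧ b = Sum.inr v) ∨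
        (a = Sum.inr v ∧ b = Sum.inl (σ v))
      adj_sub := by
        rintro a b ⟨v, ⟨rfl, rfl⟩ | ⟨rfl, rfl⟩⟩
        · exact hadj v
        · exact (hadj v).symm
      edge_vert := fun _ => Set.mem_univ _
      symm := ⟨by
        rintro a b ⟨v, ⟨rfl, rfl⟩ | ⟨rfl, rfl⟩⟩
        · exact ⟨v, Or.inr ⟨rfl, rfl⟩⟩
        · exact ⟨v, Or.inl ⟨rfl, rfl⟩⟩⟩ }
  refine ⟨S, ⟨?_, fun a => Set.mem_univ a⟩, fun u => ?_⟩
  · rintro (u | v) -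
    · obtain ⟨v, rfl⟩ := hσ.2 u
      refine ⟨Sum.inr v, ⟨v, Or.inl ⟨rfl, rfl⟩⟩, ?_⟩
      rintro b ⟨v', ⟨h, rfl⟩ | ⟨h, rfl⟩⟩
      · rw [hσ.1 (Sum.inl_injective h)]
      · cases h
    · refine ⟨Sum.inl (σ v), ⟨v, Or.inr ⟨rfl, rfl⟩⟩, ?_⟩
      rintro b ⟨v', ⟨h, rfl⟩ | ⟨h, rfl⟩⟩
      · cases h
      · rw [Sum.inr_injective h]
  · obtain ⟨v, rfl⟩ := hσ.2 u
    refine ⟨v, ?_, v, Or.inl ⟨rfl, rfl⟩⟩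
    have h1 := (σ v).isLt
    have h2 := v.isLt
    simp [conf, Nat.mod_eq_of_lt (h1.trans_le hn), hM, Nat.mod_eq_of_lt (h2.trans_le hn)]

theorem encodesPerfectMatching_of_partialMatching {mate free M : ℕ → ℕ}
    (h : A.PartialMatching mate free 0 0) (hn : n ≤ 2 ^ w) (hM : ∀ v < n, M (mate v - 1) = v)
    (R : Fin 13 → ℕ) (p : ℕ) : EncodesPerfectMatching G (conf w p R M).mem := by
  have h0 (v : Fin n) : mate v ≠ 0 := h.mate_ne_zero v.isLt
  have hlt (v : Fin n) : mate v - 1 < n := by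
    have := (h.edge v v.isLt (h0 v)).1
    have := h0 v
    omega
  have hinj : Function.Injective fun v : Fin n => (⟨mate v - 1, hlt v⟩ : Fin n) := by
    intro v v' hv
    have hv : mate v - 1 = mate v' - 1 := congrArg Fin.val hv
    have := h0 v
    have := h0 v'
    exact Fin.ext (h.inj v v.isLt v' v'.isLt (h0 v) (by omega))
  exact encodesPerfectMatching_of_bijective (Finite.injective_iff_bijective.1 hinj)
    (fun v => adj_of_nbr _ v.isLt (h.edge v v.isLt (h0 v)).2) hn (fun v => hM v v.isLt) R p

/-- The output overwrites the walk pointers, which are no longer needed; distinct `v` write to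
distinct cells because the mates are distinct. -/
theorem cost_output_loop (hq : 1 ≤ q) (hw : 8 * n ≤ 2 ^ w) {mate free : ℕ → ℕ}
    (h : A.PartialMatching mate free 0 0) (t r i l a k b u x v y : ℕ) (hi : i + r = n) (M : ℕ → ℕ)
    (hm : ∀ v < n, M (n + v) = mate v) (ho : ∀ v < i, M (mate v - 1) = v) :
    cost A w q t 39 (regs n d 0 1 l i a k b u x v y) M ≤ q ^ (7 * r + 1) * 1 := by
  have h0 (v : ℕ) (hv : v < n) : mate v ≠ 0 := h.mate_ne_zero hv
  have hpow : 0 < 2 ^ w := by positivity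
  induction r generalizing i M x y with
  | zero =>
    obtain rfl : i = n := by omega
    refine expCost_jumpEq hq rfl (by simp only [regs_apply]; omega)
      (by simp only [regs_apply]; omega) ?_
    simp only [regs_apply, if_true]
    rw [expCost_of_halted (by rfl)]
    · simp
    · exact encodesPerfectMatching_of_partialMatching h (by omega) ho _ _
  | succ r ih =>
    -- The exponent ends in a numeral so that each instruction rule can split off one factor `q`.
    change _ ≤ q ^ (7 * r + 8) * 1
    have hil : i < n := by omega
    have hmi := h0 i hil
    have hmn := (h.edge i hil hmi).1
    refine expCost_jumpEq hq rfl (by simp only [regs_apply]; omega)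
      (by simp only [regs_apply]; omega) ?_
    simp only [regs_apply, if_neg hil.ne]
    refine expCost_add hq rfl ?_
    simp only [regs_apply, regs_update]
    refine expCost_load hq rfl (by simp only [regs_apply]; omega) ?_
    simp only [regs_apply, regs_update, hm i hil]
    refine expCost_sub hq rfl (by simp only [regs_apply]; omega) ?_
    simp only [regs_apply, regs_update]
    refine expCost_store hq rfl (by simp only [regs_apply]; omega) ?_
    simp only [regs_apply]
    refine expCost_add hq rfl ?_
    simp only [regs_apply, regs_update]
    refine expCost_jump hq rfl ?_
    refine ih (i + 1) _ _ (by omega) _ (fun v hv => ?_) fun v hv => ?_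
    · rw [Function.update_of_ne (by omega), hm v hv]
    · by_cases hvi : v = i
      · simp [hvi]
      · rw [Function.update_of_ne, ho v (by omega)]
        intro hvv
        have := h0 v (by omega)
        exact hvi (h.inj v (by omega) i hil this (by omega))

/-- A bound for the exponential cost of the program whenever it starts a new walk. -/
def WalkStartBound (A : AdjArrays G d) (w : ℕ) (q K : ENNReal) (t : ℕ) : Prop :=
  ∀ (k : ℕ) (mate free M : ℕ → ℕ) (i a b u x v y : ℕ), A.PartialMatching mate free k k →
    (∀ v < n, M (n + v) = mate v) → (∀ i < k, M (2 * n + i) = free i) →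
    cost A w q t 8 (regs n d 0 1 (2 * n) i a k b u x v y) M ≤ K * (k + 1)

/-- The memory itself serves as the pointer function, and mates are stored from cell `n` on, so the
pointers survive the loop. A rotation takes 8 instructions and the final pass 6. -/
theorem cost_augment_loop (hq : 1 ≤ q) (hw : 8 * n ≤ 2 ^ w) {t : ℕ}
    (hK : WalkStartBound A w q K t) {mate free M : ℕ → ℕ} (i a k b u x v y j : ℕ)
    (h : A.Augmenting mate free M k (k + 1) j u) (hm : ∀ v < n, M (n + v) = mate v)
    (hf : ∀ i < k, M (2 * n + i) = free i) :
    cost A w q t 30 (regs n d 0 1 (2 * n) i a k b u x v y) M ≤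
      q ^ (8 * j + 6) * (K * (k + 1)) := by
  induction j using Nat.strong_induction_on generalizing mate M u x v y with
  | h j ih =>
    have hu := h.lt
    have hv := h.nxt_lt
    have hmv : mate (M u) ≤ n := by
      by_cases h0 : mate (M u) = 0
      · omega
      · exact (h.matching.edge _ hv h0).1
    refine expCost_load hq rfl (by simp only [regs_apply]; omega) ?_
    simp only [regs_apply, regs_update]
    refine expCost_add hq rfl ?_
    simp only [regs_apply, regs_update]
    refine expCost_load hq rfl (by simp only [regs_apply]; omega) ?_
    simp only [regs_apply, regs_update, hm _ hv]
    refine expCost_add hq rfl ?_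
    simp only [regs_apply, regs_update]
    refine expCost_store hq rfl (by simp only [regs_apply]; omega) ?_
    simp only [regs_apply]
    refine expCost_jumpEq hq rfl (by simp only [regs_apply]; omega)
      (by simp only [regs_apply]; omega) ?_
    simp only [regs_apply]
    have hm' (z : ℕ) (hz : z < n) : Function.update M (n + M u) (u + 1) (n + z) =
        Function.update mate (M u) (u + 1) z := by
      by_cases hzu : z = M u
      · simp [hzu]
      · simp [hzu, hm z hz]
    have hf' (i : ℕ) (hi : i < k) :
        Function.update M (n + M u) (u + 1) (2 * n + i) = free i := by
      rw [Function.update_of_ne (by omega), hf i hi]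
    by_cases h0 : mate (M u) = 0
    · rw [if_pos h0]
      refine (hK k _ free _ _ _ _ _ _ _ _ (h.finish h0) hm' hf').trans ?_
      exact le_mul_of_one_le_left' (one_le_pow₀ hq)
    · rw [if_neg h0]
      obtain ⟨j, rfl, hj⟩ := h.rotate h0
      change _ ≤ q ^ (8 * j + 8) * _
      refine expCost_sub hq rfl (by simp only [regs_apply]; omega) ?_
      simp only [regs_apply, regs_update]
      refine expCost_jump hq rfl ?_
      exact ih j (by omega) _ _ _ _ (hj.congr (fun _ _ => rfl) (fun _ _ => rfl)
        fun z hz => Function.update_of_ne (by omega) _ _) hm' hf'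

/-- Success leaves potential `K * (k + 1)`, failure `K * (k + 2)`, so the mean is governed by the
survival probability. A move costs 10; the term `8 * (j + b)` prepays the augmentation, as the
erased path has at most `j + b` matched edges. -/
theorem cost_walk (hq : 1 ≤ q) (hw : 8 * n ≤ 2 ^ w) (hd : 1 ≤ d) {t : ℕ}
    (hK : WalkStartBound A w q K t) {mate free : ℕ → ℕ} {k : ℕ}
    (h : A.PartialMatching mate free (k + 1) (k + 1)) {s : ℕ} (hs : s ≤ k) {M : ℕ → ℕ}
    (i b x v y j : ℕ) (hb : b < 2 ^ w) (hp : A.ExitPath mate M j (free s) x)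
    (hm : ∀ v < n, M (n + v) = mate v) (hf : ∀ i < k + 1, M (2 * n + i) = free i) :
    cost A w q t 16 (regs n d 0 1 (2 * n) i (2 * n + s) (k + 1) b (free s) x v y) M ≤
      q ^ (10 * b + 8 * (j + b) + 12) * (K * (k + 1 + A.survival mate b x)) := by
  have hx := hp.lt
  have hdn := A.degree_le (by omega)
  have hkn := h.le
  induction b generalizing M i x v y j with
  | zero =>
    rw [mul_zero, zero_add]
    refine expCost_jumpEq hq rfl (by simp only [regs_apply]; omega)
      (by simp only [regs_apply]; omega) ?_
    simp only [regs_apply, if_true]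
    refine (hK (k + 1) mate free M _ _ _ _ _ _ _ h hm hf).trans ?_
    rw [AdjArrays.survival, Nat.cast_add, Nat.cast_one]
    exact le_mul_of_one_le_left' (one_le_pow₀ hq)
  | succ b ih =>
    rw [show 10 * (b + 1) + 8 * (j + (b + 1)) + 12 = 10 * b + 8 * (j + b) + 30 by ring]
    refine expCost_jumpEq hq rfl (by simp only [regs_apply]; omega)
      (by simp only [regs_apply]; omega) ?_
    simp only [regs_apply, if_neg (Nat.succ_ne_zero b)]
    refine expCost_sub hq rfl (by simp only [regs_apply]; omega) ?_
    simp only [regs_apply, regs_update, Nat.add_sub_cancel]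
    refine expCost_rand hq rfl (by simp only [regs_apply]; omega)
      (by simp only [regs_apply]; omega) ?_
    simp only [regs_apply, regs_update]
    have hsum : (d : ENNReal) * (K * (k + 1 + A.survival mate (b + 1) x)) =
        ∑ l ∈ Finset.range d, K * (k + 1 + if mate (A.nbr x l) = 0 then 0 else
          A.survival mate b (mate (A.nbr x l) - 1)) := by
      rw [← Finset.mul_sum, Finset.sum_add_distrib, AdjArrays.survival, mul_left_comm, mul_add,
        ENNReal.mul_div_cancel (by simp; omega) (ENNReal.natCast_ne_top d)]
      simp only [Finset.sum_const, Finset.card_range, nsmul_eq_mul]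
    rw [hsum, Finset.mul_sum]
    refine Finset.sum_le_sum fun l hl => ?_
    have hl : l < d := Finset.mem_range.1 hl
    have hnb := A.nbr_lt hx hl
    have hmv : mate (A.nbr x l) ≤ n := by
      by_cases h0 : mate (A.nbr x l) = 0
      · omega
      · exact (h.edge _ hnb h0).1
    have hm' (z : ℕ) (hz : z < n) :
        Function.update M x (A.nbr x l) (n + z) = mate z := by
      rw [Function.update_of_ne (by omega), hm z hz]
    have hf' (i : ℕ) (hi : i < k + 1) :
        Function.update M x (A.nbr x l) (2 * n + i) = free i := by
      rw [Function.update_of_ne (by omega), hf i hi]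
    refine expCost_nbrLeft hq rfl (by simp only [regs_apply]; omega)
      (by simp only [regs_apply]; omega) ?_
    simp only [regs_apply, regs_update]
    refine expCost_store hq rfl (by simp only [regs_apply]; omega) ?_
    simp only [regs_apply]
    refine expCost_add hq rfl ?_
    simp only [regs_apply, regs_update]
    refine expCost_load hq rfl (by simp only [regs_apply]; omega) ?_
    simp only [regs_apply, regs_update, hm' _ hnb]
    refine expCost_jumpEq hq rfl (by simp only [regs_apply]; omega)
      (by simp only [regs_apply]; omega) ?_
    simp only [regs_apply]
    by_cases h0 : mate (A.nbr x l) = 0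
    · rw [if_pos h0, if_pos h0, add_zero]
      refine expCost_sub hq rfl (by simp only [regs_apply]; omega) ?_
      simp only [regs_apply, regs_update, Nat.add_sub_cancel]
      refine expCost_add hq rfl ?_
      simp only [regs_apply, regs_update]
      refine expCost_load hq rfl (by simp only [regs_apply]; omega) ?_
      simp only [regs_apply, regs_update, hf' k (by omega)]
      refine expCost_store hq rfl (by simp only [regs_apply]; omega) ?_
      simp only [regs_apply]
      obtain ⟨hr, hrs⟩ := h.remove hs
      have hfs := h.free_lt s (by omega)
      refine (cost_augment_loop hq hw hK (free := Function.update free s (free k)) (mate := mate)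
        _ _ _ _ _ _ _ _ j ⟨hr, hrs, h.free_unmatched s (by omega), x, ?_, ?_, ?_⟩ ?_ ?_).trans ?_
      · obtain ⟨p, hp0, hpj, hpn, hinj, he⟩ := hp
        refine ⟨p, hp0, hpj, hpn, hinj, fun a ha => ?_⟩
        have hpx : p a ≠ x := fun hpx => by
          have := hinj a ha.le j le_rfl (hpx.trans hpj.symm)
          omega
        have := hpn a ha.le
        rw [Function.update_of_ne (by omega), Function.update_of_ne hpx]
        exact he a ha
      · rw [Function.update_of_ne (by omega), Function.update_self]
        exact ⟨l, hl, rfl⟩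
      · rw [Function.update_of_ne (by omega), Function.update_self]
        exact h0
      · intro z hz
        rw [Function.update_of_ne (by omega), hm' z hz]
      · intro z hz
        by_cases hzs : z = s
        · simp [hzs]
        · rw [Function.update_of_ne (by omega), Function.update_of_ne hzs, hf' z (by omega)]
      · refine mul_le_mul_left (pow_le_pow_right₀ hq (by omega)) _
    · rw [if_neg h0, if_neg h0]
      refine expCost_sub hq rfl (by simp only [regs_apply]; omega) ?_
      simp only [regs_apply, regs_update]
      refine expCost_jump hq rfl ?_
      obtain ⟨j', hj', hp'⟩ := hp.extend hl (y := mate (A.nbr x l) - 1) (by omega) (by omega)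
      refine (ih _ _ _ _ j' (by omega) hp' hm' hf' hp'.lt).trans ?_
      exact mul_le_mul_left (pow_le_pow_right₀ hq (by omega)) _

/-- Induction on the cutoff rather than on `k`, since a failed walk leaves `k` unchanged. Only the
first jump of each round lowers the cutoff. The factor `q ^ (7 * n + 3)` pays for writing the
output. -/
theorem walkStartBound (hq : 1 ≤ q) (hn : 1 ≤ n) (hw : 8 * n ≤ 2 ^ w) (hd : 1 ≤ d)
    (hqk : ∀ k : ℕ, 1 ≤ k → k ≤ n →
      q ^ (36 * (n / k + 1) + 20) * (k + 2⁻¹) ≤ (k + 1 : ENNReal)) (t : ℕ) :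
    WalkStartBound A w q (q ^ (7 * n + 3)) t := by
  have hK : 1 ≤ q ^ (7 * n + 3) := one_le_pow₀ hq
  induction t with
  | zero =>
    intro k mate free M i a b u x v y h hm hf
    rw [cost, expCost, if_neg]
    · exact one_le_mul hK le_add_self
    · exact fun h => not_halted_conf (ins := .jumpEq 7 2 38) rfl (by simp) h.1
  | succ t ih =>
    intro k mate free M i a b u x v y h hm hf
    have hkn := h.le
    rcases k with _ | k
    · rw [Nat.cast_zero, zero_add]
      refine expCost_succ_le_of_exec (prog := matchingProgram) (ins := .jumpEq 7 2 38) rfl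
        (by simp) (exec_jumpEq (by simp only [regs_apply]; omega)
        (by simp only [regs_apply]; omega)) ?_
      simp only [regs_apply, if_true]
      refine expCost_move hq rfl ?_
      simp only [regs_apply, regs_update]
      exact cost_output_loop hq hw h t n 0 _ _ _ _ _ _ _ _ (by omega) M hm
        fun v hv => absurd hv (by omega)
    · have hdiv : n / (k + 1) ≤ n := Nat.div_le_self _ _
      -- The walk contributes `18 * b + 12` with `b = 2 * (n / (k + 1) + 1)`; the other 8
      -- instructions choose its length and start.
      have key : cost A w q (t + 1) 8 (regs n d 0 1 (2 * n) i a (k + 1) b u x v y) M ≤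
          q ^ (36 * (n / (k + 1) + 1) + 20) * (q ^ (7 * n + 3) * (k + 1 + 2⁻¹)) := by
        refine expCost_succ_le_of_exec (prog := matchingProgram) (ins := .jumpEq 7 2 38) rfl
          (by simp) (exec_jumpEq (by simp only [regs_apply]; omega)
          (by simp only [regs_apply]; omega)) ?_
        simp only [regs_apply, if_neg (Nat.succ_ne_zero k)]
        refine expCost_div hq rfl (by simp only [regs_apply]; omega)
          (by simp only [regs_apply]; omega) ?_
        simp only [regs_apply, regs_update]
        refine expCost_add hq rfl ?_
        simp only [regs_apply, regs_update]
        refine expCost_add hq rfl ?_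
        simp only [regs_apply, regs_update]
        refine expCost_rand hq rfl (by simp only [regs_apply]; omega)
          (by simp only [regs_apply]; omega) ?_
        simp only [regs_apply, regs_update]
        have hwalk (s : ℕ) (hs : s < k + 1) : cost A w q t 13 (regs n d 0 1 (2 * n) s a (k + 1)
            (n / (k + 1) + 1 + (n / (k + 1) + 1)) u x v y) M ≤
            q ^ (36 * (n / (k + 1) + 1) + 15) * (q ^ (7 * n + 3) * (k + 1 +
              A.survival mate (n / (k + 1) + 1 + (n / (k + 1) + 1)) (free s))) := by
          refine expCost_add hq rfl ?_
          simp only [regs_apply, regs_update]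
          refine expCost_load hq rfl (by simp only [regs_apply]; omega) ?_
          simp only [regs_apply, regs_update, hf s hs]
          refine expCost_move hq rfl ?_
          simp only [regs_apply, regs_update]
          refine (cost_walk hq hw hd ih h (by omega) _ _ _ _ _ 0 (by omega)
            (.refl (h.free_lt s hs)) hm hf).trans_eq ?_
          congr 2
          ring
        refine (Finset.sum_le_sum fun s hs => hwalk s (Finset.mem_range.1 hs)).trans ?_
        rw [← Finset.mul_sum, ← Finset.mul_sum, Finset.sum_add_distrib]
        rw [mul_left_comm ((k + 1 : ℕ) : ENNReal)]
        gcongr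
        rw [mul_add]
        gcongr
        · simp only [Finset.sum_const, Finset.card_range, nsmul_eq_mul]
          exact le_rfl
        -- With `D = n / (k + 1) + 1`, the bound `2 D S ≤ n ≤ D (k + 1)` gives `S ≤ (k + 1) / 2`.
        · have h1 := h.mul_sum_survival_free_le hd (n / (k + 1) + 1 + (n / (k + 1) + 1))
          set S := ∑ i ∈ Finset.range (k + 1),
            A.survival mate (n / (k + 1) + 1 + (n / (k + 1) + 1)) (free i)
          have h2 : n ≤ (n / (k + 1) + 1) * (k + 1) := by
            have := Nat.lt_mul_div_succ n (Nat.succ_pos k)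
            rw [Nat.succ_eq_add_one] at this
            rw [mul_comm]
            exact this.le
          set D := n / (k + 1) + 1
          have h3 : (D : ENNReal) * (2 * S) ≤ D * ((k + 1 : ℕ) : ENNReal) := by
            calc (D : ENNReal) * (2 * S) = (D + D : ℕ) * S := by push_cast; ring
              _ ≤ n := h1
              _ ≤ (D * (k + 1) : ℕ) := by exact_mod_cast h2
              _ = _ := by push_cast; ring
          have h4 := (ENNReal.mul_le_mul_iff_right (by simp [D])
            (ENNReal.natCast_ne_top D)).1 h3
          rw [← div_eq_mul_inv, ENNReal.le_div_iff_mul_le (by simp) (by simp), mul_comm]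
          exact h4
      refine key.trans ?_
      rw [mul_left_comm]
      gcongr
      have := hqk (k + 1) (by omega) hkn
      push_cast at this ⊢
      exact this

theorem cost_list_loop (hq : 1 ≤ q) (hn : 1 ≤ n) (hw : 8 * n ≤ 2 ^ w) {t : ℕ}
    (hK : WalkStartBound A w q K t) (r i a k b u x v y : ℕ) (hi : i + r = n) (M : ℕ → ℕ)
    (hm : ∀ v < n, M (n + v) = 0) (hf : ∀ s < i, M (2 * n + s) = s) :
    cost A w q t 2 (regs n d 0 1 (2 * n) i a k b u x v y) M ≤ q ^ (5 * r + 2) * (K * (n + 1)) := by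
  induction r generalizing i a M with
  | zero =>
    obtain rfl : i = n := by omega
    refine expCost_jumpEq hq rfl (by simp only [regs_apply]; omega)
      (by simp only [regs_apply]; omega) ?_
    simp only [regs_apply, if_true]
    refine expCost_move hq rfl ?_
    simp only [regs_apply, regs_update]
    rw [pow_zero, one_mul]
    refine hK i (fun _ => 0) id M _ _ _ _ _ _ _
      ⟨fun v hv h => absurd rfl h, fun v hv v' hv' h => absurd rfl h, fun i hi => hi,
        fun i hi j hj h => h, fun i hi v hv h => by omega, by simp⟩ hm hf
  | succ r ih =>
    change _ ≤ q ^ (5 * r + 7) * _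
    refine expCost_jumpEq hq rfl (by simp only [regs_apply]; omega)
      (by simp only [regs_apply]; omega) ?_
    simp only [regs_apply, if_neg (show i ≠ n by omega)]
    refine expCost_add hq rfl ?_
    simp only [regs_apply, regs_update]
    refine expCost_store hq rfl (by simp only [regs_apply]; omega) ?_
    simp only [regs_apply]
    refine expCost_add hq rfl ?_
    simp only [regs_apply, regs_update]
    refine expCost_jump hq rfl ?_
    refine ih _ _ (by omega) _ (fun v hv => ?_) fun s hs => ?_
    · rw [Function.update_of_ne (by omega), hm v hv]
    · by_cases hsi : s = i
      · simp [hsi]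
      · rw [Function.update_of_ne (by omega), hf s (by omega)]

theorem expCost_init_le (hq : 1 ≤ q) (hn : 1 ≤ n) (hw : 8 * n ≤ 2 ^ w) (hd : 1 ≤ d)
    (hqk : ∀ k : ℕ, 1 ≤ k → k ≤ n →
      q ^ (36 * (n / k + 1) + 20) * (k + 2⁻¹) ≤ (k + 1 : ENNReal)) (t : ℕ) :
    expCost A matchingProgram (fun s => EncodesPerfectMatching G s.mem) q t (init 13 w n d) ≤
      q ^ (12 * n + 7) * (n + 1) := by
  have hinit : init 13 w n d = conf w 0 (regs n d 0 0 0 0 0 0 0 0 0 0 0) fun _ => 0 := by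
    ext1
    · rfl
    · funext j
      fin_cases j <;> rfl
    · rfl
  rw [hinit]
  have h := cost_list_loop hq hn hw (walkStartBound (A := A) hq hn hw hd hqk t) n 0 0 0 0 0 0 0 0
    (by omega) (fun _ => 0) (fun _ _ => rfl) (fun s hs => absurd hs (by omega))
  have h2 : cost A w q t 0 (regs n d 0 0 0 0 0 0 0 0 0 0 0) (fun _ => 0) ≤
      q ^ (5 * n + 4) * (q ^ (7 * n + 3) * (n + 1)) := by
    refine expCost_const hq rfl ?_
    simp only [regs_update]
    refine expCost_add hq rfl ?_
    simp only [regs_apply, regs_update, ← two_mul]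
    exact h
  refine h2.trans_eq ?_
  rw [← mul_assoc, ← pow_add]
  congr 2
  ring

end Program

end WordRAM

/-! ### From the exponential tail to the running time bounds. -/

namespace WordRAM

section RunTime

variable {k w n d : ℕ} {G : SimpleGraph (Fin n ⊕ Fin n)} (A : AdjArrays G d)
  (prog : List (Instr k))

theorem runTime_le {ω : ℕ → Sample} {t : ℕ} (h : Halted prog (config A prog w ω t)) :
    runTime A prog w ω ≤ t :=
  iInf₂_le t h

theorem runTime_le_tsum (ω : ℕ → Sample) : (runTime A prog w ω : ENNReal) ≤
    ∑' t, {ω | ¬ Halted prog (config A prog w ω t)}.indicator 1 ω := by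
  classical
  by_cases h : ∃ t, Halted prog (config A prog w ω t)
  · calc (runTime A prog w ω : ENNReal) ≤ ((Nat.find h : ℕ∞) : ENNReal) :=
          ENat.toENNReal_le.2 (runTime_le A prog (Nat.find_spec h))
      _ = ∑ t ∈ Finset.range (Nat.find h),
          {ω | ¬ Halted prog (config A prog w ω t)}.indicator 1 ω := by
          rw [Finset.sum_congr rfl fun t ht => Set.indicator_of_mem
            (show ω ∈ {ω | ¬ Halted prog (config A prog w ω t)} from
              Nat.find_min h (Finset.mem_range.1 ht)) 1]
          simp
      _ ≤ _ := ENNReal.sum_le_tsum _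
  · push Not at h
    have h1 (t : ℕ) : {ω | ¬ Halted prog (config A prog w ω t)}.indicator
        (1 : (ℕ → Sample) → ENNReal) ω = 1 :=
      Set.indicator_of_mem (h t) 1
    simp only [h1]
    rw [ENNReal.tsum_const_eq_top_of_ne_zero one_ne_zero]
    exact le_top

theorem lintegral_tsum_alive : ∫⁻ ω, ∑' t,
    {ω | ¬ Halted prog (config A prog w ω t)}.indicator 1 ω ∂coins =
      ∑' t, coins {ω | ¬ Halted prog (config A prog w ω t)} := by
  rw [lintegral_tsum fun t =>
    (measurable_one.indicator (measurableSet_alive A prog w t)).aemeasurable]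
  exact tsum_congr fun t => lintegral_indicator_one (measurableSet_alive A prog w t)

theorem setOf_lt_runTime_subset {x : ℝ} (hx : 0 ≤ x) :
    {ω | ENNReal.ofReal x < (runTime A prog w ω : ENNReal)} ⊆
      {ω | ¬ Halted prog (config A prog w ω ⌊x⌋₊)} := by
  intro ω hω h
  refine absurd (Set.mem_ofPred_eq ▸ hω) (not_lt.2 ?_)
  calc (runTime A prog w ω : ENNReal) ≤ ((⌊x⌋₊ : ℕ∞) : ENNReal) :=
        ENat.toENNReal_le.2 (runTime_le A prog h)
    _ = ENNReal.ofReal ⌊x⌋₊ := by simp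
    _ ≤ _ := ENNReal.ofReal_le_ofReal (Nat.floor_le hx)

end RunTime

/-- The first `⌈log B / θ⌉` terms are bounded by 1; from there on `B` is absorbed and a geometric
series of sum at most `1 + 1 / θ` remains. -/
theorem tsum_le_of_le_exp {p : ℕ → ENNReal} {B θ : ℝ} (hB : 1 ≤ B) (hθ : 0 < θ)
    (h1 : ∀ t, p t ≤ 1) (h : ∀ t : ℕ, p t ≤ ENNReal.ofReal (B * Real.exp (-(t * θ)))) :
    ∑' t, p t ≤ ENNReal.ofReal (Real.log B / θ + 2 + 1 / θ) := by
  have hlog : 0 ≤ Real.log B / θ := div_nonneg (Real.log_nonneg hB) hθ.le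
  have hexp : Real.exp (-θ) < 1 := Real.exp_lt_one_iff.2 (by linarith)
  have hexp2 : (1 - Real.exp (-θ))⁻¹ ≤ 1 + 1 / θ := by
    have h2 : Real.exp (-θ) * (1 + θ) ≤ 1 := by
      calc Real.exp (-θ) * (1 + θ) ≤ Real.exp (-θ) * Real.exp θ := by
            gcongr; linarith [Real.add_one_le_exp θ]
        _ = 1 := by rw [← Real.exp_add]; simp
    rw [inv_le_iff_one_le_mul₀ (by linarith)]
    have h3 : (1 + 1 / θ) * (1 - Real.exp (-θ)) =
        1 + (1 - Real.exp (-θ) * (1 + θ)) / θ := by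
      field_simp; ring
    rw [h3]
    have := div_nonneg (sub_nonneg.2 h2) hθ.le
    linarith
  set m := ⌈Real.log B / θ⌉₊ with hm
  have htail (i : ℕ) : p (i + m) ≤ ENNReal.ofReal (Real.exp (-θ)) ^ i := by
    refine (h _).trans ?_
    rw [← ENNReal.ofReal_pow (Real.exp_nonneg _), ← Real.exp_nat_mul]
    refine ENNReal.ofReal_le_ofReal ?_
    have h2 : Real.log B ≤ m * θ := (div_le_iff₀ hθ).1 (Nat.le_ceil _)
    calc B * Real.exp (-((i + m : ℕ) * θ))
        = Real.exp (Real.log B + -((i + m : ℕ) * θ)) := by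
          rw [Real.exp_add, Real.exp_log (by linarith)]
      _ ≤ _ := by
          refine Real.exp_le_exp.2 ?_
          push_cast
          linarith
  rw [← Summable.sum_add_tsum_nat_add' (k := m) ENNReal.summable]
  calc ∑ t ∈ Finset.range m, p t + ∑' i, p (i + m)
      ≤ ∑ _t ∈ Finset.range m, 1 + ∑' i : ℕ, ENNReal.ofReal (Real.exp (-θ)) ^ i :=
        add_le_add (Finset.sum_le_sum fun t _ => h1 t) (ENNReal.tsum_le_tsum htail)
    _ = ENNReal.ofReal m + ENNReal.ofReal (1 - Real.exp (-θ))⁻¹ := by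
        rw [ENNReal.tsum_geometric, ENNReal.ofReal_inv_of_pos (by linarith),
          ENNReal.ofReal_sub _ (Real.exp_nonneg _)]
        simp
    _ ≤ ENNReal.ofReal (Real.log B / θ + 1) + ENNReal.ofReal (1 + 1 / θ) := by
        gcongr
        exact (Nat.ceil_lt_add_one hlog).le
    _ = _ := by
        rw [← ENNReal.ofReal_add (by linarith) (by positivity)]
        congr 1; ring

/-- As `n / k ≥ 1`, the exponent is at most `100 n / k`, and 600 makes the factor at most `exp (1 /
(6 k)) ≤ 1 / (1 - 1 / (6 k))`. Finally `(1 - 1 / (6 k)) (k + 1) ≥ k + 2/3`. -/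
theorem exp_pow_mul_le {n k : ℕ} (hk : 1 ≤ k) (hkn : k ≤ n) :
    ENNReal.ofReal (Real.exp (1 / (600 * n))) ^ (36 * (n / k + 1) + 20) * (k + 2⁻¹) ≤
      (k + 1 : ENNReal) := by
  have hk' : (1 : ℝ) ≤ k := by exact_mod_cast hk
  have hkn' : (k : ℝ) ≤ n := by exact_mod_cast hkn
  have hn' : (0 : ℝ) < n := by linarith
  have h1 : (k + 2⁻¹ : ENNReal) = ENNReal.ofReal (k + 1 / 2) := by
    rw [ENNReal.ofReal_add (by linarith) (by norm_num), one_div,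
      ENNReal.ofReal_inv_of_pos (by norm_num)]
    simp
  have h2 : (k + 1 : ENNReal) = ENNReal.ofReal (k + 1) := by
    rw [ENNReal.ofReal_add (by linarith) (by norm_num)]
    simp
  rw [h1, h2, ← ENNReal.ofReal_pow (Real.exp_nonneg _), ← Real.exp_nat_mul,
    ← ENNReal.ofReal_mul (Real.exp_nonneg _)]
  refine ENNReal.ofReal_le_ofReal ?_
  have h3 : ((36 * (n / k + 1) + 20 : ℕ) : ℝ) * (1 / (600 * n)) ≤ 1 / (6 * k) := by
    have h4 : ((n / k : ℕ) : ℝ) ≤ n / k := Nat.cast_div_le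
    have h5 : (1 : ℝ) ≤ n / k := by rw [le_div_iff₀ (by linarith)]; linarith
    calc ((36 * (n / k + 1) + 20 : ℕ) : ℝ) * (1 / (600 * n))
        ≤ (100 * (n / k)) * (1 / (600 * n)) := by
          gcongr
          push_cast
          linarith
      _ = 1 / (6 * k) := by field_simp; norm_num
  have h6 : 1 / (6 * (k : ℝ)) ≤ 1 / 6 := by
    rw [div_le_div_iff₀ (by linarith) (by norm_num)]; linarith
  have h7 : Real.exp (1 / (6 * (k : ℝ))) * (1 - 1 / (6 * k)) ≤ 1 := by
    calc _ ≤ Real.exp (1 / (6 * (k : ℝ))) * Real.exp (-(1 / (6 * k))) := by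
          gcongr; exact Real.one_sub_le_exp_neg _
      _ = 1 := by rw [← Real.exp_add]; simp
  have h8 : (k : ℝ) + 1 / 2 ≤ (1 - 1 / (6 * k)) * (k + 1) := by
    have : (1 - 1 / (6 * (k : ℝ))) * (k + 1) = k + 1 - 1 / 6 - 1 / (6 * k) := by
      field_simp; ring
    linarith
  calc _ ≤ Real.exp (1 / (6 * (k : ℝ))) * ((1 - 1 / (6 * k)) * (k + 1)) := by gcongr
    _ = Real.exp (1 / (6 * (k : ℝ))) * (1 - 1 / (6 * k)) * (k + 1) := by ring
    _ ≤ 1 * (k + 1) := by gcongr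
    _ = _ := one_mul _

section Program

variable {n d w : ℕ} {G : SimpleGraph (Fin n ⊕ Fin n)} (A : AdjArrays G d)

theorem expCost_init_le_ofReal (hn : 1 ≤ n) (hd : 1 ≤ d) (hw : 8 * n ≤ 2 ^ w) (t : ℕ) :
    expCost A matchingProgram (fun s => EncodesPerfectMatching G s.mem)
      (ENNReal.ofReal (Real.exp (1 / (600 * n)))) t (init 13 w n d) ≤
      ENNReal.ofReal (3 * (n + 1)) := by
  have hn' : (1 : ℝ) ≤ n := by exact_mod_cast hn
  have hq : 1 ≤ ENNReal.ofReal (Real.exp (1 / (600 * n))) := by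
    rw [ENNReal.one_le_ofReal]
    exact Real.one_le_exp (by positivity)
  refine (expCost_init_le hq hn hw hd (fun k hk hkn => exp_pow_mul_le hk hkn) t).trans ?_
  rw [ENNReal.ofReal_mul (by norm_num)]
  gcongr
  · rw [← ENNReal.ofReal_pow (Real.exp_nonneg _), ← Real.exp_nat_mul]
    refine ENNReal.ofReal_le_ofReal ?_
    have h1 : ((12 * n + 7 : ℕ) : ℝ) * (1 / (600 * n)) ≤ 1 := by
      rw [mul_one_div, div_le_one (by positivity)]
      push_cast
      linarith
    have := Real.exp_le_exp.2 h1
    linarith [Real.exp_one_lt_d9]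
  · rw [ENNReal.ofReal_add (by linarith) (by norm_num)]
    simp

theorem encodesPerfectMatching_of_halted (hn : 1 ≤ n) (hd : 1 ≤ d) (hw : 8 * n ≤ 2 ^ w)
    (ω : ℕ → Sample) (t : ℕ) (h : Halted matchingProgram (config A matchingProgram w ω t)) :
    EncodesPerfectMatching G (config A matchingProgram w ω t).mem := by
  have hq : 1 ≤ ENNReal.ofReal (Real.exp (1 / (600 * n))) := by
    rw [ENNReal.one_le_ofReal]
    exact Real.one_le_exp (by positivity)
  have h2 := post_of_expCost_ne_top (A := A) (prog := matchingProgram) (w := w)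
    (post := fun s => EncodesPerfectMatching G s.mem) hq ω t 0
    ((expCost_init_le_ofReal A hn hd hw t).trans_lt ENNReal.ofReal_lt_top).ne
  rw [zero_add] at h2
  exact h2 h

theorem coins_alive_le_exp (hn : 1 ≤ n) (hd : 1 ≤ d) (hw : 8 * n ≤ 2 ^ w) (t : ℕ) :
    coins {ω | ¬ Halted matchingProgram (config A matchingProgram w ω t)} ≤
      ENNReal.ofReal (3 * (n + 1) * Real.exp (-(t * (1 / (600 * n))))) := by
  have h := (coins_alive_le (A := A) (prog := matchingProgram) (w := w) t).trans
    (expCost_init_le_ofReal A hn hd hw t)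
  rw [← ENNReal.ofReal_pow (Real.exp_nonneg _), ← Real.exp_nat_mul] at h
  rw [Real.exp_neg, ← div_eq_mul_inv, ENNReal.ofReal_div_of_pos (Real.exp_pos _),
    ENNReal.le_div_iff_mul_le (by simp [Real.exp_pos]) (by simp), mul_comm]
  exact h

theorem tsum_alive_le (hn : 1 ≤ n) (hd : 1 ≤ d) (hw : 8 * n ≤ 2 ^ w) :
    ∑' t, coins {ω | ¬ Halted matchingProgram (config A matchingProgram w ω t)} ≤
      ENNReal.ofReal (600 * n * Real.log (3 * (n + 1)) + 2 + 600 * n) := by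
  have hn' : (1 : ℝ) ≤ n := by exact_mod_cast hn
  refine (tsum_le_of_le_exp (B := 3 * (n + 1)) (θ := 1 / (600 * n)) (by linarith)
    (by positivity) (fun t => prob_le_one) (coins_alive_le_exp A hn hd hw)).trans_eq ?_
  congr 1
  field_simp

theorem runTime_ne_top_ae (hn : 1 ≤ n) (hd : 1 ≤ d) (hw : 8 * n ≤ 2 ^ w) :
    ∀ᵐ ω ∂coins, runTime A matchingProgram w ω ≠ ⊤ := by
  have h := ae_lt_top (μ := coins) (f := fun ω => ∑' t,
    {ω | ¬ Halted matchingProgram (config A matchingProgram w ω t)}.indicator 1 ω)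
    (Measurable.tsum fun t =>
      measurable_one.indicator (measurableSet_alive A matchingProgram w t))
    (by rw [lintegral_tsum_alive]
        exact ((tsum_alive_le A hn hd hw).trans_lt ENNReal.ofReal_lt_top).ne)
  filter_upwards [h] with ω hω htop
  have := (runTime_le_tsum A matchingProgram (w := w) ω).trans_lt hω
  rw [htop] at this
  simp at this

theorem lintegral_runTime_le (hn : 2 ≤ n) (hd : 1 ≤ d) (hw : 8 * n ≤ 2 ^ w) :
    ∫⁻ ω, (runTime A matchingProgram w ω : ENNReal) ∂coins ≤
      ENNReal.ofReal (4000 * (n * Real.log n)) := by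
  have hn' : (2 : ℝ) ≤ n := by exact_mod_cast hn
  refine (lintegral_mono (runTime_le_tsum A matchingProgram)).trans ?_
  rw [lintegral_tsum_alive]
  refine (tsum_alive_le A (by omega) hd hw).trans (ENNReal.ofReal_le_ofReal ?_)
  have hL : 1 / 2 ≤ Real.log n := by
    have := Real.log_le_log (by norm_num) hn'
    linarith [Real.log_two_gt_d9]
  -- For `n ≥ 2`, `3 (n + 1) ≤ 8 n ≤ n ^ 4`.
  have h3 : Real.log (3 * (n + 1)) ≤ 4 * Real.log n := by
    rw [show (4 : ℝ) * Real.log n = Real.log (n ^ 4) by rw [Real.log_pow]; norm_num]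
    refine Real.log_le_log (by linarith) ?_
    have : (2 : ℝ) ^ 3 ≤ n ^ 3 := by gcongr
    nlinarith
  have h4 : 600 * n * Real.log (3 * (n + 1)) ≤ 600 * n * (4 * Real.log n) := by gcongr
  nlinarith

theorem coins_lt_runTime_le (hn : 2 ≤ n) (hd : 1 ≤ d) (hw : 8 * n ≤ 2 ^ w) {a : ℝ} (ha : 0 < a) :
    coins {ω | ENNReal.ofReal (600 * (a + 6) * (n * Real.log n)) <
      (runTime A matchingProgram w ω : ENNReal)} ≤ ENNReal.ofReal ((n : ℝ) ^ (-a)) := by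
  have hn' : (2 : ℝ) ≤ n := by exact_mod_cast hn
  have hL : 0 ≤ Real.log n := Real.log_nonneg (by linarith)
  set x := 600 * (a + 6) * (n * Real.log n) with hx
  refine (measure_mono (setOf_lt_runTime_subset A matchingProgram (x := x)
    (by positivity))).trans ((coins_alive_le_exp A (by omega) hd hw _).trans
    (ENNReal.ofReal_le_ofReal ?_))
  -- Rounding `x` down costs at most `1 / (600 n) ≤ 1` in the exponent. The 6 in `a + 6` gives a
  -- factor `n ^ (-6)` that absorbs the resulting `3 (n + 1) e`.
  have h1 : -(⌊x⌋₊ * (1 / (600 * (n : ℝ)))) ≤ 1 + -((a + 6) * Real.log n) := by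
    have h2 : x - 1 ≤ ⌊x⌋₊ := (Nat.sub_one_lt_floor x).le
    have h3 : (x - 1) * (1 / (600 * (n : ℝ))) ≤ ⌊x⌋₊ * (1 / (600 * (n : ℝ))) := by gcongr
    have h4 : (x - 1) * (1 / (600 * (n : ℝ))) = (a + 6) * Real.log n - 1 / (600 * n) := by
      rw [hx]; field_simp
    have h5 : 1 / (600 * (n : ℝ)) ≤ 1 := by
      rw [div_le_one (by positivity)]; linarith
    linarith
  have h6 : 3 * ((n : ℝ) + 1) * Real.exp 1 ≤ n ^ 6 := by
    have h7 : (2 : ℝ) ^ 5 ≤ n ^ 5 := by gcongr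
    have h8 := Real.exp_one_lt_d9
    calc 3 * ((n : ℝ) + 1) * Real.exp 1 ≤ 3 * (n + 1) * 3 := by gcongr; linarith
      _ ≤ n ^ 6 := by nlinarith
  calc 3 * ((n : ℝ) + 1) * Real.exp (-(⌊x⌋₊ * (1 / (600 * (n : ℝ)))))
      ≤ 3 * ((n : ℝ) + 1) * Real.exp (1 + -((a + 6) * Real.log n)) := by gcongr
    _ = 3 * ((n : ℝ) + 1) * Real.exp 1 * Real.exp (-((a + 6) * Real.log n)) := by
        rw [Real.exp_add]; ring
    _ ≤ n ^ 6 * Real.exp (-((a + 6) * Real.log n)) := by gcongr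
    _ = (n : ℝ) ^ (-a) := by
        rw [Real.rpow_def_of_pos (by linarith), ← Real.exp_log (show (0 : ℝ) < n ^ 6 by positivity),
          ← Real.exp_add, Real.log_pow]
        congr 1
        push_cast
        ring

end Program

end WordRAM

theorem theorem1 :
    ∃ (k : ℕ) (prog : List (WordRAM.Instr k)) (c : ℕ) (C : ℝ) (D : ℝ → ℝ),
      ∀ (n d w : ℕ) (G : SimpleGraph (Fin n ⊕ Fin n)) [G.LocallyFinite] (A : AdjArrays G d),
        1 ≤ n → 1 ≤ d → c * n ≤ 2 ^ w →
        G ≤ completeBipartiteGraph (Fin n) (Fin n) → G.IsRegularOfDegree d →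
        (∀ (ω : ℕ → WordRAM.Sample) (t : ℕ),
          WordRAM.Halted prog (WordRAM.config A prog w ω t) →
            WordRAM.EncodesPerfectMatching G (WordRAM.config A prog w ω t).mem) ∧
        (∀ᵐ ω ∂WordRAM.coins, WordRAM.runTime A prog w ω ≠ ⊤) ∧
        (2 ≤ n →
          ∫⁻ ω, (WordRAM.runTime A prog w ω : ENNReal) ∂WordRAM.coins ≤
            ENNReal.ofReal (C * (n * Real.log n))) ∧
        (2 ≤ n → ∀ a : ℝ, 0 < a →
          WordRAM.coins {ω | ENNReal.ofReal (D a * (n * Real.log n)) <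
              (WordRAM.runTime A prog w ω : ENNReal)} ≤
            ENNReal.ofReal ((n : ℝ) ^ (-a))) := by
  -- Addresses stay below `3 n` and walk lengths are at most `2 n + 2`, so `8 n ≤ 2 ^ w` rules out
  -- overflow.
  refine ⟨13, WordRAM.matchingProgram, 8, 4000, fun a => 600 * (a + 6), ?_⟩
  intro n d w G _ A hn hd hw _ _
  exact ⟨WordRAM.encodesPerfectMatching_of_halted A hn hd hw,
    WordRAM.runTime_ne_top_ae A hn hd hw,
    fun hn2 => WordRAM.lintegral_runTime_le A hn2 hd hw,
    fun hn2 a ha => WordRAM.coins_lt_runTime_le A hn2 hd hw ha⟩
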